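/- Let $S=\Gamma\backslash\mathbb{H}^2$ be a closed orientable hyperbolic surface, where the covering group $\Gamma$ acts freely, properly discontinuously and cocompactly by orientation-preserving isometries, and let $\pi:\mathbb{H}^2\to S$ be the projection. Let $f:S\to S$ be a homeomorphism isotopic to the identity, and let $\tilde f:\mathbb{H}^2\to\mathbb{H}^2$ be its preferred lift, i.e. the unique lift commuting with every element of $\Gamma$. For $x\in S$ and $n\ge 0$ put $L_n(x)=d(\tilde x,\tilde f^n(\tilde x))$, where $\tilde x$ is any lift of $x$. The point $x$ has rotation speed $\vartheta(x)$ if $$\vartheta(x)=\lim_{n\to+\infty}\tfrac1n L_n(x)=\lim_{n\to+\infty}\tfrac1n L_n(f^{-n}(x)).$$ A geodesic is a local isometry $\gamma:\mathbb{R}\to S$; it is simple if it has no transverse self-intersection, that is, if $\gamma(s)=\gamma(t)$ implies $\dot\gamma(s)=\dot\gamma(t)$. A geodesic $\gamma$ is a tracking geodesic of $x$ if $\vartheta(x)$ exists, $\vartheta(x)>0$, and for every lift $\tilde x$ of $x$ there is a lift $\tilde\gamma$ of $\gamma$ with $$\lim_{n\to+\infty}\tfrac1n d\big(\tilde f^n(\tilde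 x),\tilde\gamma(n\vartheta(x))\big)=\lim_{n\to+\infty}\tfrac1n d\big(\tilde f^{-n}(\tilde x),\tilde\gamma(-n\vartheta(x))\big)=0.$$ It is normalized if moreover $d(\tilde x,\tilde\gamma(0))=d(\tilde x,\tilde\gamma(\mathbb{R}))$ for some such pair $\tilde x,\tilde\gamma$. A point which has a tracking geodesic has exactly one normalized tracking geodesic, denoted $\gamma_x$. A geodesic lamination is a closed set $\Lambda\subset S$ of the form $\Lambda=\bigcup_{x\in\Lambda}\beta_x(\mathbb{R})$, where each $\beta_x$ is a simple geodesic with $\beta_x(0)=x$ and, for all $x,y\in\Lambda$, the sets $\beta_x(\mathbb{R})$ and $\beta_y(\mathbb{R})$ are disjoint or equal. It is minimal if $\Lambda=\overline{\beta_x(\mathbb{R})}$ for all $x\in\Lambda$. **Theorem 1.10.** Let $\mu$ be an ergodic $f$-invariant Borel probability measure on $S$ with positive rotation speed, i.e. there is a constant $\vartheta_\mu>0$ with $\vartheta(x)=\vartheta_\mu$ for $\mu$-a.e. $x\in S$. Suppose that $\gamma_x$ is simple for $\mu$-a.e. $x\in S$ (at points where it exists). Then there exists a minimal geodesic lamination $\Lambda_\mu\subset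 S$ such that, for $\mu$-a.e. $x\in S$, the geodesic $\gamma_x$ exists and $$\overline{\gamma_x(\mathbb{R})}=\Lambda_\mu.$$ -/

import Mathlib

open Filter Topology MeasureTheory Set
open scoped UpperHalfPlane MatrixGroups

namespace HypSurf

/-- The quotient `Γ \ ℍ` of the hyperbolic plane (the upper half plane with Mathlib's hyperbolic
distance) by a group of orientation preserving isometries. A subgroup of `PSL(2, ℝ)` is represented
by a subgroup of `SL(2, ℝ)`; the possible elements `±1` of `Γ` act trivially. -/
def Surface (Γ : Subgroup SL(2, ℝ)) : Type := MulAction.orbitRel.Quotient Γ ℍ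

/-- The quotient topology. -/
instance (Γ : Subgroup SL(2, ℝ)) : TopologicalSpace (Surface Γ) :=
  inferInstanceAs (TopologicalSpace (Quotient (MulAction.orbitRel Γ ℍ)))

/-- The Borel σ-algebra. -/
instance (Γ : Subgroup SL(2, ℝ)) : MeasurableSpace (Surface Γ) := borel _

instance (Γ : Subgroup SL(2, ℝ)) : BorelSpace (Surface Γ) := ⟨rfl⟩

/-- The universal covering projection `ℍ → S = Γ \ ℍ`. -/
noncomputable def proj (Γ : Subgroup SL(2, ℝ)) (z : ℍ) : Surface Γ := Quotient.mk (MulAction.orbitRel Γ ℍ) z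

/-- `Γ \ ℍ` is a closed orientable hyperbolic surface with group of covering transformations (the
image in `PSL(2, ℝ)` of) `Γ`: the action is properly discontinuous and free (an element with a fixed
point acts trivially), and the quotient is compact. -/
structure IsClosedSurfaceGroup (Γ : Subgroup SL(2, ℝ)) : Prop where
  discrete : ProperlyDiscontinuousSMul Γ ℍ
  free : ∀ g ∈ Γ, ∀ z : ℍ, g • z = z → ∀ w : ℍ, g • w = w
  cocompact : CompactSpace (Surface Γ)

/-- The distance of the hyperbolic metric on `S`: the infimum of the distances between lifts. -/
noncomputable def surfDist (Γ : Subgroup SL(2, ℝ)) (x y : Surface Γ) : ℝ :=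
  sInf {d : ℝ | ∃ z w : ℍ, proj Γ z = x ∧ proj Γ w = y ∧ d = dist z w}

/-- A (complete, unit speed, parametrized) geodesic of `S`: a local isometry `ℝ → S`. -/
def IsGeodesic (Γ : Subgroup SL(2, ℝ)) (γ : ℝ → Surface Γ) : Prop :=
  ∀ t : ℝ, ∃ ε > 0, ∀ s ∈ Metric.ball t ε, ∀ s' ∈ Metric.ball t ε,
    surfDist Γ (γ s) (γ s') = |s - s'|

/-- `c` is a lift of the geodesic `γ`: a geodesic line of the hyperbolic plane (that is, an isometric
embedding of `ℝ`) which projects to `γ`, with the same parametrization. -/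
def IsGeodesicLift (Γ : Subgroup SL(2, ℝ)) (γ : ℝ → Surface Γ) (c : ℝ → ℍ) : Prop :=
  Isometry c ∧ ∀ t, proj Γ (c t) = γ t

/-- A geodesic of `S` is simple if it has no transverse self-intersection: `γ s = γ t` implies that
the unit tangent vectors of `γ` at `s` and `t` coincide. (A unit tangent vector is the same thing as
the parametrized geodesic which it generates. Opposite tangent vectors cannot occur, as `γ` would
then run backwards through its own midpoint.) -/
def IsSimpleGeodesic (Γ : Subgroup SL(2, ℝ)) (γ : ℝ → Surface Γ) : Prop :=
  IsGeodesic Γ γ ∧ ∀ s t : ℝ, γ s = γ t → ∀ u : ℝ, γ (s + u) = γ (t + u)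

/-- `f` belongs to `Homeo₀(S)`: it is isotopic to the identity (through homeomorphisms). -/
def IsotopicToId {X : Type*} [TopologicalSpace X] (f : X ≃ₜ X) : Prop :=
  ∃ H : unitInterval × X → X, Continuous H ∧ (∀ x, H (0, x) = x) ∧ (∀ x, H (1, x) = f x) ∧
    ∀ t, IsHomeomorph fun x => H (t, x)

/-- `F` is the preferred lift of `f`: the lift of `f` to the hyperbolic plane which commutes with all
the covering transformations. It exists and is unique for `f` isotopic to the identity on a closed
hyperbolic surface. -/
structure IsPreferredLift (Γ : Subgroup SL(2, ℝ)) (f : Surface Γ ≃ₜ Surface Γ) (F : ℍ ≃ₜ ℍ) :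
    Prop where
  lifts : ∀ z, proj Γ (F z) = f (proj Γ z)
  commutes : ∀ g ∈ Γ, ∀ z, F (g • z) = g • F z

/-- The rotation distance `L_n(x) = d(x̃, F^n(x̃))`, where `x̃` is any lift of `x`. -/
noncomputable def rotDist (Γ : Subgroup SL(2, ℝ)) (F : ℍ ≃ₜ ℍ) (n : ℕ) (x : Surface Γ) : ℝ :=
  dist (Quotient.out x) (F^[n] (Quotient.out x))

/-- The point `x` has rotation speed `θ`: the averages `L_n(x) / n` and `L_n(f^{-n}(x)) / n` both
converge to `θ`. -/
def HasRotationSpeed (Γ : Subgroup SL(2, ℝ)) (f : Surface Γ ≃ₜ Surface Γ) (F : ℍ ≃ₜ ℍ)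
    (x : Surface Γ) (θ : ℝ) : Prop :=
  Tendsto (fun n : ℕ => rotDist Γ F n x / n) atTop (𝓝 θ) ∧
  Tendsto (fun n : ℕ => rotDist Γ F n (f.symm^[n] x) / n) atTop (𝓝 θ)

/-- `μ` is an ergodic `f`-invariant Borel probability measure with positive rotation speed: almost
every point has rotation speed equal to one and the same positive constant. -/
def IsErgodicPosSpeed (Γ : Subgroup SL(2, ℝ)) (f : Surface Γ ≃ₜ Surface Γ) (F : ℍ ≃ₜ ℍ)
    (μ : Measure (Surface Γ)) : Prop :=
  IsProbabilityMeasure μ ∧ Ergodic f μ ∧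
    ∃ θ : ℝ, 0 < θ ∧ ∀ᵐ x ∂μ, HasRotationSpeed Γ f F x θ

/-- The tracking equation for a point `z` and a geodesic line `c` of the hyperbolic plane. -/
def Tracks (F : ℍ ≃ₜ ℍ) (θ : ℝ) (z : ℍ) (c : ℝ → ℍ) : Prop :=
  Tendsto (fun n : ℕ => dist (F^[n] z) (c (n * θ)) / n) atTop (𝓝 0) ∧
  Tendsto (fun n : ℕ => dist (F.symm^[n] z) (c (-(n * θ))) / n) atTop (𝓝 0)

/-- `γ` is a tracking geodesic of the point `x`. -/
def IsTrackingGeodesic (Γ : Subgroup SL(2, ℝ)) (f : Surface Γ ≃ₜ Surface Γ) (F : ℍ ≃ₜ ℍ)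
    (x : Surface Γ) (γ : ℝ → Surface Γ) : Prop :=
  IsGeodesic Γ γ ∧ ∃ θ : ℝ, 0 < θ ∧ HasRotationSpeed Γ f F x θ ∧
    ∀ z : ℍ, proj Γ z = x → ∃ c : ℝ → ℍ, IsGeodesicLift Γ γ c ∧ Tracks F θ z c

/-- `γ` is the normalized tracking geodesic `γ_x` of the point `x`: for some lifts satisfying the
tracking equation, the point of parameter `0` realizes the distance from the lift of `x`. -/
def IsNormalizedTracking (Γ : Subgroup SL(2, ℝ)) (f : Surface Γ ≃ₜ Surface Γ) (F : ℍ ≃ₜ ℍ)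
    (x : Surface Γ) (γ : ℝ → Surface Γ) : Prop :=
  IsTrackingGeodesic Γ f F x γ ∧ ∃ (θ : ℝ) (z : ℍ) (c : ℝ → ℍ), HasRotationSpeed Γ f F x θ ∧
    proj Γ z = x ∧ IsGeodesicLift Γ γ c ∧ Tracks F θ z c ∧
    dist z (c 0) = Metric.infDist z (range c)

/-- `Λ` is a geodesic lamination of `S`, the leaf through `x ∈ Λ` being the image of `β x`. -/
structure IsGeodesicLamination (Γ : Subgroup SL(2, ℝ)) (Λ : Set (Surface Γ))
    (β : Surface Γ → ℝ → Surface Γ) : Prop where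
  isClosed : IsClosed Λ
  eq_iUnion : Λ = ⋃ x ∈ Λ, range (β x)
  simple : ∀ x ∈ Λ, IsSimpleGeodesic Γ (β x)
  base : ∀ x ∈ Λ, β x 0 = x
  leaves : ∀ x ∈ Λ, ∀ y ∈ Λ, Disjoint (range (β x)) (range (β y)) ∨ range (β x) = range (β y)

/-- `Λ` is a minimal geodesic lamination of `S`: every leaf is dense in `Λ`. -/
def IsMinimalGeodesicLamination (Γ : Subgroup SL(2, ℝ)) (Λ : Set (Surface Γ)) : Prop :=
  ∃ β : Surface Γ → ℝ → Surface Γ, IsGeodesicLamination Γ Λ β ∧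
    ∀ x ∈ Λ, Λ = closure (range (β x))

end HypSurf

open HypSurf

namespace HypSurf

open UpperHalfPlane (I)

/-! ### Matrices in `SL(2, ℝ)` and geodesics of the hyperbolic plane -/

/-! Up to sign, a unit tangent vector of the hyperbolic plane is an element of `SL(2, ℝ)`: the
geodesic flow is right multiplication by `dg t`, reversal is right multiplication by `weyl`, and
covering transformations act on the left. The closure of a geodesic of the surface corresponds to
the closure of `flowOrbit Γ g` (`closure_range_eq_support`), and the relative position of two
geodesics is read off from the entries of `h⁻¹ * g`.

Tracking geodesics exist almost everywhere. An orbit with bounded steps and positive linear speed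
has exponentially converging directions, hence follows a ray up to a sublinear error
(`exists_ray_tracking`). The forward and backward rays have different endpoints: by invariance of
the measure, the distance between the n-th backward and the n-th forward iterate, divided by n,
tends to `2 * θ` in measure, which excludes the limit zero (`IsPreferredLift.ae_exists_tracks`).

A point and its image have the same tracking geodesic. Ergodicity therefore makes the closure of
this geodesic almost everywhere constant (`exists_closure_flowOrbit_eq`), and Poincaré recurrence
makes the geodesic recurrent in both directions (`ae_isForwardRecurrent`, for `F` and for `F.symm`).

The rest is hyperbolic geometry: a recurrent geodesic without self-crossings has minimal closure
(`mem_of_isForwardRecurrent`). Suppose that a closed invariant set `N` in the closure misses `g`. No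
geodesic of `N` shares an endpoint with a translate of `g`, since recurrence would carry `g` into
`N`. So translates of `g` run beside nearest geodesics of `N` in long thin strips. No other geodesic
of `N` fits into such a strip (`eventually_same_geodesic`), so at either end the strips accumulate
along one and the same geodesic. Comparing two strips at both ends yields a covering translation
along a geodesic of `N`; a translate of `g` which follows this axis for longer than the translation
length crosses its own image (`false_of_close_pairs`). -/

lemma det_eq (g : SL(2, ℝ)) : g 0 0 * g 1 1 - g 0 1 * g 1 0 = 1 := by
  have := g.det_coe
  rwa [Matrix.det_fin_two] at this

lemma mul_apply_two (g h : SL(2, ℝ)) (i j : Fin 2) :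
    (g * h) i j = g i 0 * h 0 j + g i 1 * h 1 j := by
  simp [Matrix.mul_apply, Fin.sum_univ_two]

lemma inv_apply_00 (g : SL(2, ℝ)) : (g⁻¹) 0 0 = g 1 1 := by
  simp [Matrix.SpecialLinearGroup.coe_inv, Matrix.adjugate_fin_two]
lemma inv_apply_01 (g : SL(2, ℝ)) : (g⁻¹) 0 1 = - g 0 1 := by
  simp [Matrix.SpecialLinearGroup.coe_inv, Matrix.adjugate_fin_two]
lemma inv_apply_10 (g : SL(2, ℝ)) : (g⁻¹) 1 0 = - g 1 0 := by
  simp [Matrix.SpecialLinearGroup.coe_inv, Matrix.adjugate_fin_two]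
lemma inv_apply_11 (g : SL(2, ℝ)) : (g⁻¹) 1 1 = g 0 0 := by
  simp [Matrix.SpecialLinearGroup.coe_inv, Matrix.adjugate_fin_two]

lemma ext_two {g h : SL(2, ℝ)} (h00 : g 0 0 = h 0 0) (h01 : g 0 1 = h 0 1) (h10 : g 1 0 = h 1 0)
    (h11 : g 1 1 = h 1 1) : g = h := by
  ext i j
  fin_cases i <;> fin_cases j <;> assumption

/-- The diagonal matrix generating the geodesic flow. -/
noncomputable def dg (t : ℝ) : SL(2, ℝ) :=
  ⟨!![Real.exp (t / 2), 0; 0, Real.exp (-t / 2)], by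
    rw [Matrix.det_fin_two_of, ← Real.exp_add]; simp [neg_div]⟩

/-- The rotation by a half turn around `I`. -/
def weyl : SL(2, ℝ) := ⟨!![0, -1; 1, 0], by simp [Matrix.det_fin_two_of]⟩

@[simp] lemma dg_00 (t : ℝ) : dg t 0 0 = Real.exp (t / 2) := rfl
@[simp] lemma dg_01 (t : ℝ) : dg t 0 1 = 0 := rfl
@[simp] lemma dg_10 (t : ℝ) : dg t 1 0 = 0 := rfl
@[simp] lemma dg_11 (t : ℝ) : dg t 1 1 = Real.exp (-t / 2) := rfl
@[simp] lemma weyl_00 : weyl 0 0 = 0 := rfl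
@[simp] lemma weyl_01 : weyl 0 1 = -1 := rfl
@[simp] lemma weyl_10 : weyl 1 0 = 1 := rfl
@[simp] lemma weyl_11 : weyl 1 1 = 0 := rfl
@[simp] lemma neg_apply_two (g : SL(2, ℝ)) (i j : Fin 2) : (-g) i j = - g i j := by
  simp [Matrix.SpecialLinearGroup.coe_neg]

lemma dg_add (s t : ℝ) : dg (s + t) = dg s * dg t := by
  apply ext_two <;> simp [mul_apply_two, ← Real.exp_add, add_div, add_comm]

@[simp] lemma dg_zero : dg 0 = 1 := by
  apply ext_two <;> simp

lemma dg_inv (t : ℝ) : (dg t)⁻¹ = dg (-t) := by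
  rw [inv_eq_iff_mul_eq_one, ← dg_add]; simp

lemma weyl_mul_dg (t : ℝ) : weyl * dg t = dg (-t) * weyl := by
  apply ext_two <;> simp [mul_apply_two]

/-- A diagonal matrix with positive entries is of the form `dg t`. -/
lemma eq_dg {k : SL(2, ℝ)} (h01 : k 0 1 = 0) (h10 : k 1 0 = 0) (h : 0 < k 0 0) :
    k = dg (2 * Real.log (k 0 0)) := by
  have hd := det_eq k
  rw [h01, zero_mul, sub_zero] at hd
  have h11 : k 1 1 = (k 0 0)⁻¹ := eq_inv_of_mul_eq_one_right hd
  apply ext_two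
  · rw [dg_00, mul_div_cancel_left₀ _ two_ne_zero, Real.exp_log h]
  · simp [h01]
  · simp [h10]
  · rw [dg_11, neg_div, mul_div_cancel_left₀ _ two_ne_zero, Real.exp_neg, Real.exp_log h, h11]

/-- The normalizer of the geodesic flow: the stabilizer of the vertical geodesic. -/
def Nrm : Subgroup SL(2, ℝ) where
  carrier := {q | (q 0 1 = 0 ∧ q 1 0 = 0) ∨ (q 0 0 = 0 ∧ q 1 1 = 0)}
  mul_mem' := by
    rintro a b (⟨h1, h2⟩ | ⟨h1, h2⟩) (⟨h3, h4⟩ | ⟨h3, h4⟩) <;>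
      simp [mul_apply_two, h1, h2, h3, h4]
  one_mem' := by left; simp
  inv_mem' := by
    rintro a (⟨h1, h2⟩ | ⟨h1, h2⟩)
    · left; rw [inv_apply_01, inv_apply_10]; simp [h1, h2]
    · right; rw [inv_apply_00, inv_apply_11]; simp [h1, h2]

lemma dg_mem_Nrm (t : ℝ) : dg t ∈ Nrm := Or.inl ⟨rfl, rfl⟩
lemma weyl_mem_Nrm : weyl ∈ Nrm := Or.inr ⟨rfl, rfl⟩
lemma neg_one_mem_Nrm : (-1 : SL(2, ℝ)) ∈ Nrm := by left; simp

lemma Nrm_cases {q : SL(2, ℝ)} (hq : q ∈ Nrm) :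
    ∃ t, q = dg t ∨ q = -dg t ∨ q = dg t * weyl ∨ q = -(dg t * weyl) := by
  have hdiag : ∀ k : SL(2, ℝ), k 0 1 = 0 → k 1 0 = 0 → ∃ t, k = dg t ∨ k = -dg t := by
    intro k h1 h2
    have hd := det_eq k
    rcases lt_trichotomy (k 0 0) 0 with h | h | h
    · refine ⟨2 * Real.log ((-k) 0 0), Or.inr ?_⟩
      rw [← eq_dg (k := -k) (by simp [h1]) (by simp [h2]) (by simpa using h), neg_neg]
    · rw [h, h1] at hd; simp at hd
    · exact ⟨_, Or.inl (eq_dg h1 h2 h)⟩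
  rcases hq with ⟨h1, h2⟩ | ⟨h1, h2⟩
  · obtain ⟨t, h | h⟩ := hdiag q h1 h2
    · exact ⟨t, Or.inl h⟩
    · exact ⟨t, Or.inr (Or.inl h)⟩
  · obtain ⟨t, h | h⟩ := hdiag (q * weyl⁻¹)
      (by simp [mul_apply_two, inv_apply_01, inv_apply_11, h1])
      (by simp [mul_apply_two, inv_apply_10, inv_apply_00, h2])
    · exact ⟨t, Or.inr (Or.inr (Or.inl (mul_inv_eq_iff_eq_mul.1 h)))⟩
    · refine ⟨t, Or.inr (Or.inr (Or.inr ?_))⟩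
      rw [mul_inv_eq_iff_eq_mul.1 h, neg_mul]

/-- The product of the entries: it is negative if and only if the image of the vertical geodesic
under `k` crosses the vertical geodesic transversally. -/
def crossProd (k : SL(2, ℝ)) : ℝ := k 0 0 * k 0 1 * k 1 0 * k 1 1

lemma sq_mul_sq_of_Nrm {q : SL(2, ℝ)} (hq : q ∈ Nrm) :
    ((q 0 1 = 0 ∧ q 1 0 = 0) ∧ q 0 0 * q 1 1 = 1) ∨
      ((q 0 0 = 0 ∧ q 1 1 = 0) ∧ q 0 1 * q 1 0 = -1) := by
  have := det_eq q
  rcases hq with ⟨h1, h2⟩ | ⟨h1, h2⟩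
  · left; refine ⟨⟨h1, h2⟩, ?_⟩; rw [h1] at this; linarith
  · right; refine ⟨⟨h1, h2⟩, ?_⟩; rw [h1] at this; linarith

/-- Diagonal elements scale the two rows by reciprocal factors, antidiagonal ones also swap them,
and each row contributes two factors. Together with the version for columns, this makes `crossProd
(h⁻¹ * g)` depend only on the two unoriented geodesics. -/
lemma crossProd_mul_left {q : SL(2, ℝ)} (hq : q ∈ Nrm) (k : SL(2, ℝ)) :
    crossProd (q * k) = crossProd k := by
  rcases sq_mul_sq_of_Nrm hq with ⟨⟨h1, h2⟩, h3⟩ | ⟨⟨h1, h2⟩, h3⟩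
  · simp only [crossProd, mul_apply_two, h1, h2]
    linear_combination (q 0 0 * q 1 1 + 1) * k 0 0 * k 0 1 * k 1 0 * k 1 1 * h3
  · simp only [crossProd, mul_apply_two, h1, h2]
    linear_combination (q 0 1 * q 1 0 - 1) * k 0 0 * k 0 1 * k 1 0 * k 1 1 * h3

lemma crossProd_mul_right {q : SL(2, ℝ)} (hq : q ∈ Nrm) (k : SL(2, ℝ)) :
    crossProd (k * q) = crossProd k := by
  rcases sq_mul_sq_of_Nrm hq with ⟨⟨h1, h2⟩, h3⟩ | ⟨⟨h1, h2⟩, h3⟩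
  · simp only [crossProd, mul_apply_two, h1, h2]
    linear_combination (q 0 0 * q 1 1 + 1) * k 0 0 * k 0 1 * k 1 0 * k 1 1 * h3
  · simp only [crossProd, mul_apply_two, h1, h2]
    linear_combination (q 0 1 * q 1 0 - 1) * k 0 0 * k 0 1 * k 1 0 * k 1 1 * h3

@[fun_prop]
lemma continuous_entry (i j : Fin 2) : Continuous fun k : SL(2, ℝ) => k i j := by fun_prop

lemma continuous_crossProd : Continuous crossProd := by
  unfold crossProd; fun_prop

lemma tendsto_SL_iff {α : Type*} {l : Filter α} {u : α → SL(2, ℝ)} {g : SL(2, ℝ)} :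
    Tendsto u l (𝓝 g) ↔ ∀ i j, Tendsto (fun n => u n i j) l (𝓝 (g i j)) := by
  have h := (Matrix.SpecialLinearGroup.isClosedEmbedding_val
    (n := Fin 2) (R := ℝ)).isEmbedding.tendsto_nhds_iff (f := u) (l := l) (y := g)
  refine h.trans (tendsto_pi_nhds.trans (forall_congr' fun i => tendsto_pi_nhds))

/-! #### The action on the base point -/

lemma smul_I_im (g : SL(2, ℝ)) : (g • I).im = 1 / ((g 1 0) ^ 2 + (g 1 1) ^ 2) := by
  have h : ((g • I : ℍ) : ℂ) = _ := UpperHalfPlane.coe_specialLinearGroup_apply g I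
  rw [← UpperHalfPlane.coe_im, h]
  have hd := det_eq g
  have : (g 1 0) ^ 2 + (g 1 1) ^ 2 ≠ 0 := by
    intro h0
    have h1 : g 1 0 = 0 := by nlinarith [sq_nonneg (g 1 0), sq_nonneg (g 1 1)]
    have h2 : g 1 1 = 0 := by nlinarith [sq_nonneg (g 1 0), sq_nonneg (g 1 1)]
    simp [h1, h2] at hd
  simp only [UpperHalfPlane.coe_I, Complex.div_im, Complex.normSq_apply]
  simp
  have h' : g 1 1 ^ 2 + g 1 0 ^ 2 ≠ 0 := by rwa [add_comm]
  field_simp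
  linear_combination ((g 1 0) ^ 2 + (g 1 1) ^ 2) * hd

lemma smul_I_re (g : SL(2, ℝ)) :
    (g • I).re = (g 0 0 * g 1 0 + g 0 1 * g 1 1) / ((g 1 0) ^ 2 + (g 1 1) ^ 2) := by
  have h : ((g • I : ℍ) : ℂ) = _ := UpperHalfPlane.coe_specialLinearGroup_apply g I
  rw [← UpperHalfPlane.coe_re, h]
  simp [Complex.div_re, Complex.normSq_apply]
  field_simp
  ring

lemma denom_sq_pos (g : SL(2, ℝ)) : 0 < (g 1 0) ^ 2 + (g 1 1) ^ 2 := by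
  have := (g • I).im_pos
  rw [smul_I_im] at this
  exact one_div_pos.1 this

/-- The sum of the squares of the entries. -/
def normSq (g : SL(2, ℝ)) : ℝ := (g 0 0) ^ 2 + (g 0 1) ^ 2 + (g 1 0) ^ 2 + (g 1 1) ^ 2

lemma two_cosh_dist (z : ℍ) :
    2 * Real.cosh (dist z I) = (z.re ^ 2 + z.im ^ 2 + 1) / z.im := by
  rw [UpperHalfPlane.cosh_dist, Complex.dist_eq, ← Complex.normSq_eq_norm_sq, Complex.normSq_apply]
  have := z.im_ne_zero
  simp
  field_simp
  ring

/-- Turns distance estimates into polynomial estimates on matrix entries. -/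
lemma two_cosh_dist_smul_I (g : SL(2, ℝ)) : 2 * Real.cosh (dist (g • I) I) = normSq g := by
  rw [two_cosh_dist, smul_I_re, smul_I_im]
  have h := (denom_sq_pos g).ne'
  have hd := det_eq g
  have : (g 0 0 * g 1 0 + g 0 1 * g 1 1) ^ 2 + 1 =
      ((g 0 0) ^ 2 + (g 0 1) ^ 2) * ((g 1 0) ^ 2 + (g 1 1) ^ 2) := by
    linear_combination (-(g 0 0 * g 1 1 - g 0 1 * g 1 0) - 1) * hd
  unfold normSq
  field_simp
  linear_combination this

lemma dist_smul_smul (g h : SL(2, ℝ)) (z w : ℍ) :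
    dist (g • z) (h • w) = dist ((h⁻¹ * g) • z) w := by
  rw [← dist_smul h⁻¹, smul_smul, inv_smul_smul]

lemma two_cosh_dist_smul_smul (g h : SL(2, ℝ)) :
    2 * Real.cosh (dist (g • I) (h • I)) = normSq (h⁻¹ * g) := by
  rw [dist_smul_smul, two_cosh_dist_smul_I]

/-! ### Geodesic lines as orbits of the diagonal flow -/

/-- The geodesic of the hyperbolic plane with initial unit tangent vector `g`. -/
noncomputable def geo (g : SL(2, ℝ)) (t : ℝ) : ℍ := (g * dg t) • I

lemma geo_def (g : SL(2, ℝ)) (t : ℝ) : geo g t = (g * dg t) • I := rfl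

lemma geo_zero (g : SL(2, ℝ)) : geo g 0 = g • I := by simp [geo]

lemma geo_mul (h g : SL(2, ℝ)) (t : ℝ) : geo (h * g) t = h • geo g t := by
  rw [geo, geo, mul_assoc, mul_smul]

lemma geo_mul_dg (g : SL(2, ℝ)) (s t : ℝ) : geo (g * dg s) t = geo g (s + t) := by
  rw [geo, geo, mul_assoc, dg_add]

lemma neg_smul_pt (g : SL(2, ℝ)) (z : ℍ) : (-g) • z = g • z := by
  apply UpperHalfPlane.ext
  rw [UpperHalfPlane.coe_specialLinearGroup_apply, UpperHalfPlane.coe_specialLinearGroup_apply]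
  simp
  rw [← neg_div_neg_eq]
  ring_nf

lemma geo_neg (g : SL(2, ℝ)) (t : ℝ) : geo (-g) t = geo g t := by
  rw [geo, geo, neg_mul, neg_smul_pt]

lemma im_geo_one (t : ℝ) : (dg t • I).im = Real.exp t := by
  rw [smul_I_im]
  simp [← Real.exp_nat_mul, ← Real.exp_neg]
  ring_nf

lemma re_geo_one (t : ℝ) : (dg t • I).re = 0 := by
  rw [smul_I_re]; simp

lemma eq_dg_smul_of_re_eq_zero {z : ℍ} (h : z.re = 0) : z = dg (Real.log z.im) • I := by
  apply UpperHalfPlane.ext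
  apply Complex.ext
  · simp [h, re_geo_one]
  · simp [im_geo_one, Real.exp_log z.im_pos]

lemma weyl_smul_I : weyl • I = I := by
  apply UpperHalfPlane.ext
  apply Complex.ext
  · rw [UpperHalfPlane.coe_re, smul_I_re]; simp
  · rw [UpperHalfPlane.coe_im, smul_I_im]; simp

lemma geo_mul_weyl (g : SL(2, ℝ)) (t : ℝ) : geo (g * weyl) t = geo g (-t) := by
  rw [geo, geo, mul_assoc, weyl_mul_dg, ← mul_assoc, mul_smul, weyl_smul_I]

lemma range_geo_mul {q : SL(2, ℝ)} (hq : q ∈ Nrm) (g : SL(2, ℝ)) :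
    range (geo (g * q)) = range (geo g) := by
  have hdg : ∀ (g : SL(2, ℝ)) t, range (geo (g * dg t)) = range (geo g) := by
    intro g t
    have : geo (g * dg t) = geo g ∘ (t + ·) := by ext s; simp [geo_mul_dg]
    rw [this]; exact (Equiv.addLeft t).surjective.range_comp _
  have hw : ∀ (g : SL(2, ℝ)), range (geo (g * weyl)) = range (geo g) := by
    intro g
    have : geo (g * weyl) = geo g ∘ (- ·) := by ext s; simp [geo_mul_weyl]
    rw [this]; exact (Equiv.neg ℝ).surjective.range_comp _
  have hn : ∀ (g : SL(2, ℝ)), range (geo (-g)) = range (geo g) := by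
    intro g; congr 1; ext t; rw [geo_neg]
  obtain ⟨t, h | h | h | h⟩ := Nrm_cases hq
  · rw [h, hdg]
  · rw [h, mul_neg, hn, hdg]
  · rw [h, ← mul_assoc, hw, hdg]
  · rw [h, mul_neg, hn, ← mul_assoc, hw, hdg]

lemma dist_geo_one (s t : ℝ) : dist (dg s • I) (dg t • I) = |s - t| := by
  rw [UpperHalfPlane.dist_of_re_eq (by rw [re_geo_one, re_geo_one]), im_geo_one, im_geo_one,
    Real.log_exp, Real.log_exp, Real.dist_eq]

lemma dist_geo (g : SL(2, ℝ)) (s t : ℝ) : dist (geo g s) (geo g t) = |s - t| := by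
  rw [geo, geo, mul_smul, mul_smul, dist_smul, dist_geo_one]

lemma isometry_geo (g : SL(2, ℝ)) : Isometry (geo g) :=
  Isometry.of_dist_eq fun s t => by rw [dist_geo, Real.dist_eq]

lemma continuous_dg : Continuous dg := by
  refine continuous_iff_continuousAt.2 fun t => tendsto_SL_iff.2 fun i j => ?_
  have h : Continuous fun t => dg t i j := by
    fin_cases i <;> fin_cases j <;> simp <;> fun_prop
  exact h.tendsto t

lemma continuous_geo₂ : Continuous fun p : SL(2, ℝ) × ℝ => geo p.1 p.2 := by
  unfold geo
  have := continuous_dg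
  fun_prop

/-! ### Rotations, polar coordinates and classification of geodesic lines -/

/-- The rotation around `I` with first column `(p, q)`. -/
def rot (p q : ℝ) (h : p ^ 2 + q ^ 2 = 1) : SL(2, ℝ) :=
  ⟨!![p, -q; q, p], by rw [Matrix.det_fin_two_of]; linear_combination h⟩

@[simp] lemma rot_00 (p q h) : rot p q h 0 0 = p := rfl
@[simp] lemma rot_01 (p q h) : rot p q h 0 1 = -q := rfl
@[simp] lemma rot_10 (p q h) : rot p q h 1 0 = q := rfl
@[simp] lemma rot_11 (p q h) : rot p q h 1 1 = p := rfl

/-- A complex square root of the unit number `x + iy`; matrices in `SL(2, ℝ)` rotate the plane by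
twice their angle. -/
lemma exists_half_angle {x y : ℝ} (h : x ^ 2 + y ^ 2 = 1) :
    ∃ p q : ℝ, p ^ 2 + q ^ 2 = 1 ∧ p ^ 2 - q ^ 2 = x ∧ 2 * p * q = y := by
  obtain ⟨w, hw⟩ := IsAlgClosed.exists_pow_nat_eq (⟨x, y⟩ : ℂ) (n := 2) two_pos
  have h1 : w.re ^ 2 - w.im ^ 2 = x := by simpa [sq] using congrArg Complex.re hw
  have h2 : 2 * w.re * w.im = y := by
    have := congrArg Complex.im hw
    simp [sq] at this; linarith
  refine ⟨w.re, w.im, ?_, h1, h2⟩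
  have : (w.re ^ 2 + w.im ^ 2) ^ 2 = 1 := by rw [← h, ← h1, ← h2]; ring
  nlinarith [sq_nonneg w.re, sq_nonneg w.im]

/-- Polar coordinates around `I`. -/
lemma exists_polar (z : ℍ) : ∃ (p q : ℝ) (h : p ^ 2 + q ^ 2 = 1),
    z = geo (rot p q h) (dist z I) := by
  have hc := two_cosh_dist z
  set R := dist z I with hR
  have hy := z.im_ne_zero
  rcases eq_or_ne R 0 with h0 | h0
  · refine ⟨1, 0, by norm_num, ?_⟩
    have hz : z = I := dist_eq_zero.1 h0
    have : rot 1 0 (by norm_num) = 1 := by apply ext_two <;> simp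
    rw [h0, geo_zero, this, one_smul, hz]
  have hs : Real.sinh R ≠ 0 := by simpa using h0
  have hcosh : Real.cosh R = (z.re ^ 2 + z.im ^ 2 + 1) / (2 * z.im) := by
    field_simp at hc ⊢
    linarith
  have hss : Real.sinh R ^ 2 = ((z.re ^ 2 + z.im ^ 2 - 1) / (2 * z.im)) ^ 2
      + (z.re / z.im) ^ 2 := by
    rw [Real.sinh_sq, hcosh]
    field_simp
    ring
  -- By `hss`, the two arguments are the coordinates of the unit vector pointing from `I` towards
  -- `z`.
  obtain ⟨p, q, h, h1, h2⟩ := exists_half_angle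
    (x := (z.re ^ 2 + z.im ^ 2 - 1) / (2 * z.im) / Real.sinh R)
    (y := z.re / z.im / Real.sinh R) (by
      rw [div_pow, div_pow _ (Real.sinh R), ← add_div, ← hss, div_self (pow_ne_zero 2 hs)])
  refine ⟨p, q, h, ?_⟩
  rw [eq_div_iff hs] at h1 h2
  have e1 : Real.exp (R / 2) ^ 2 = Real.cosh R + Real.sinh R := by
    rw [← Real.exp_nat_mul, Real.cosh_add_sinh]; ring_nf
  have e2 : Real.exp (-R / 2) ^ 2 = Real.cosh R - Real.sinh R := by
    rw [← Real.exp_nat_mul, Real.cosh_sub_sinh]; ring_nf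
  have hden : (q * Real.exp (R / 2)) ^ 2 + (p * Real.exp (-R / 2)) ^ 2 = 1 / z.im := by
    rw [mul_pow, mul_pow, e1, e2]
    have : q ^ 2 * (Real.cosh R + Real.sinh R) + p ^ 2 * (Real.cosh R - Real.sinh R)
      = (p ^ 2 + q ^ 2) * Real.cosh R - (p ^ 2 - q ^ 2) * Real.sinh R := by ring
    rw [this, h, h1, hcosh]
    field_simp
    ring
  have hnum : p * Real.exp (R / 2) * (q * Real.exp (R / 2))
      + -(q * Real.exp (-R / 2)) * (p * Real.exp (-R / 2)) = z.re / z.im := by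
    rw [← h2]
    linear_combination p * q * e1 - p * q * e2
  apply UpperHalfPlane.ext
  apply Complex.ext
  · rw [UpperHalfPlane.coe_re, UpperHalfPlane.coe_re, geo, smul_I_re]
    simp only [mul_apply_two, rot_00, rot_01, rot_10, rot_11, dg_00, dg_01, dg_10, dg_11, mul_zero,
      zero_add, add_zero, neg_mul] at hden hnum ⊢
    rw [hden, hnum]
    field_simp
  · rw [UpperHalfPlane.coe_im, UpperHalfPlane.coe_im, geo, smul_I_im]
    simp only [mul_apply_two, rot_10, rot_11, dg_00, dg_01, dg_10, dg_11, mul_zero,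
      zero_add, add_zero]
    rw [hden]
    field_simp

lemma rot_smul_I (p q h) : rot p q h • I = I := by
  apply UpperHalfPlane.ext
  apply Complex.ext
  · rw [UpperHalfPlane.coe_re, smul_I_re]; simp; left; ring
  · rw [UpperHalfPlane.coe_im, smul_I_im]; simp [add_comm, h]

/-- Two points of the hyperbolic plane are joined by a geodesic. -/
lemma exists_geo_joining (z w : ℍ) : ∃ g : SL(2, ℝ), geo g 0 = z ∧ geo g (dist z w) = w := by
  obtain ⟨u, rfl⟩ := MulAction.exists_smul_eq SL(2, ℝ) I z
  obtain ⟨p, q, h, hw⟩ := exists_polar (u⁻¹ • w)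
  refine ⟨u * rot p q h, ?_, ?_⟩
  · rw [geo_zero, mul_smul, rot_smul_I]
  · rw [geo_mul, ← dist_smul u⁻¹ (u • I) w, inv_smul_smul, dist_comm, ← hw, smul_inv_smul]

/-- A point of the hyperbolic plane is determined by its distances to two points of a geodesic, if
it could lie on this geodesic. -/
lemma eq_dg_smul_of_dist {z : ℍ} {t : ℝ} (h0 : dist z I = |t|) (h1 : dist z (dg 1 • I) = |t - 1|) :
    z = dg t • I := by
  have hy := z.im_ne_zero
  have e0 : (z.re ^ 2 + z.im ^ 2 + 1) / z.im = Real.exp t + Real.exp (-t) := by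
    rw [← two_cosh_dist, h0, Real.cosh_abs, Real.cosh_eq]; ring
  have e1 : (z.re ^ 2 + z.im ^ 2 + Real.exp 1 ^ 2) / (Real.exp 1 * z.im)
      = Real.exp (t - 1) + Real.exp (-(t - 1)) := by
    have h2 : 2 * Real.cosh (dist z (dg 1 • I)) = Real.exp (t - 1) + Real.exp (-(t - 1)) := by
      rw [h1, Real.cosh_abs, Real.cosh_eq]; ring
    rw [← h2, UpperHalfPlane.cosh_dist, Complex.dist_eq, ← Complex.normSq_eq_norm_sq,
      Complex.normSq_apply]
    simp only [Complex.sub_re, Complex.sub_im, UpperHalfPlane.coe_re, UpperHalfPlane.coe_im,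
      re_geo_one, im_geo_one]
    field_simp
    ring
  have he := Real.exp_pos 1
  rw [div_eq_iff hy] at e0
  rw [div_eq_iff (by positivity), Real.exp_sub, neg_sub, Real.exp_sub] at e1
  rw [Real.exp_neg] at e0
  have ht := Real.exp_pos t
  have hE : 1 < Real.exp 1 := Real.one_lt_exp_iff.2 one_pos
  set E := Real.exp 1
  set T := Real.exp t
  have hE2 : E ^ 2 - 1 ≠ 0 := by nlinarith
  have hyT : z.im = T := by
    field_simp at e0 e1
    have : (E ^ 2 - 1) * (z.im - T) = 0 := by
      have h3 := e0
      nlinarith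
    rcases mul_eq_zero.1 this with h | h
    · exact absurd h hE2
    · linarith
  have hx : z.re = 0 := by
    rw [hyT] at e0
    field_simp at e0
    nlinarith
  rw [eq_dg_smul_of_re_eq_zero hx, hyT, Real.log_exp]

/-- Every geodesic line of the hyperbolic plane is given by a unit tangent vector. -/
lemma exists_eq_geo {c : ℝ → ℍ} (hc : Isometry c) : ∃ g : SL(2, ℝ), c = geo g := by
  obtain ⟨g, h0, h1⟩ := exists_geo_joining (c 0) (c 1)
  rw [hc.dist_eq, Real.dist_eq] at h1
  norm_num at h1
  refine ⟨g, funext fun t => ?_⟩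
  have key : g⁻¹ • c t = dg t • I := by
    apply eq_dg_smul_of_dist
    · rw [← dist_smul g, smul_inv_smul, ← geo_zero g, h0, hc.dist_eq, Real.dist_eq, sub_zero]
    · rw [← dist_smul g, smul_inv_smul, smul_smul, ← geo_def, h1, hc.dist_eq, Real.dist_eq]
  rw [geo, mul_smul, ← key, smul_inv_smul]

/-! ### Recurrent geodesics without self-crossings have minimal closure -/

/-- Gives access to countable bases and analytic sets in the measurability arguments. -/
instance : PolishSpace SL(2, ℝ) :=
  haveI : PolishSpace (Matrix (Fin 2) (Fin 2) ℝ) :=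
    inferInstanceAs (PolishSpace (Fin 2 → Fin 2 → ℝ))
  Matrix.SpecialLinearGroup.isClosedEmbedding_val.polishSpace

/-- The unit tangent vectors of all translates under `Γ` of the geodesic line of `g`, in both
directions. -/
def flowOrbit (Γ : Subgroup SL(2, ℝ)) (g : SL(2, ℝ)) : Set SL(2, ℝ) :=
  {γ | ∃ T ∈ Γ, ∃ q ∈ Nrm, γ = T * g * q}

/-- Invariance under `Γ` and under the geodesic flow. -/
structure IsFlowInvariant (Γ : Subgroup SL(2, ℝ)) (N : Set SL(2, ℝ)) : Prop where
  left : ∀ T ∈ Γ, ∀ h ∈ N, T * h ∈ N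
  right : ∀ q ∈ Nrm, ∀ h ∈ N, h * q ∈ N

/-- In the quotient by `Γ`, the geodesic of `g` returns to any neighbourhood of `g` at arbitrarily
large times. -/
def IsForwardRecurrent (Γ : Subgroup SL(2, ℝ)) (g : SL(2, ℝ)) : Prop :=
  ∀ V ∈ 𝓝 g, ∀ R : ℝ, ∃ T ∈ Γ, ∃ s ≥ R, ∃ e : SL(2, ℝ), (e = 1 ∨ e = -1) ∧ T * g * dg s * e ∈ V

section Recurrent

variable {Γ : Subgroup SL(2, ℝ)} {g : SL(2, ℝ)} {N : Set SL(2, ℝ)}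

lemma isFlowInvariant_flowOrbit (Γ : Subgroup SL(2, ℝ)) (g : SL(2, ℝ)) :
    IsFlowInvariant Γ (flowOrbit Γ g) := by
  refine ⟨?_, ?_⟩
  · rintro T hT _ ⟨T', hT', q, hq, rfl⟩
    exact ⟨T * T', Γ.mul_mem hT hT', q, hq, by simp only [mul_assoc]⟩
  · rintro q hq _ ⟨T, hT, q', hq', rfl⟩
    exact ⟨T, hT, q' * q, Nrm.mul_mem hq' hq, by simp only [mul_assoc]⟩

lemma mem_flowOrbit_self (Γ : Subgroup SL(2, ℝ)) (g : SL(2, ℝ)) : g ∈ flowOrbit Γ g :=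
  ⟨1, Γ.one_mem, 1, Nrm.one_mem, by simp⟩

lemma IsFlowInvariant.closure (h : IsFlowInvariant Γ N) : IsFlowInvariant Γ (closure N) := by
  refine ⟨fun T hT x hx => ?_, fun q hq x hx => ?_⟩
  · exact map_mem_closure (continuous_const_mul T) hx fun y hy => h.left T hT y hy
  · exact map_mem_closure (f := fun y => y * q) (continuous_mul_const q) hx fun y hy => h.right q hq y hy

/-- The vanishing entry says that `g` and `h` have the same forward endpoint. Flowing both contracts
the remaining off-diagonal entry of their relative position, so along the return times of `g` the
translates of `h` converge to `g` up to a shift `δ` along its own geodesic. -/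
lemma mem_of_recurrent_of_asymptotic (hN : IsFlowInvariant Γ N) (hcl : IsClosed N)
    (hrec : IsForwardRecurrent Γ g) {h : SL(2, ℝ)} (hh : h ∈ N) (hk : (h⁻¹ * g) 1 0 = 0) :
    g ∈ N := by
  obtain ⟨V, hV⟩ := (𝓝 g).exists_antitone_basis
  choose T hT s hs e he hmem using fun n : ℕ => hrec (V n) (hV.1.mem_of_mem trivial) n
  set k := h⁻¹ * g with hkdef
  have hd := det_eq k
  rw [hk, mul_zero, sub_zero] at hd
  let δ : SL(2, ℝ) := ⟨!![k 1 1, 0; 0, k 0 0], by rw [Matrix.det_fin_two_of]; linarith⟩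
  have hδ : δ ∈ Nrm := Or.inl ⟨rfl, rfl⟩
  have hst : Tendsto s atTop atTop := tendsto_atTop_mono hs tendsto_natCast_atTop_atTop
  have h1 : Tendsto (fun n => T n * g * dg (s n) * e n) atTop (𝓝 g) := hV.tendsto hmem
  have h2 : Tendsto (fun n => dg (-(s n)) * k⁻¹ * dg (s n)) atTop (𝓝 δ) := by
    refine tendsto_SL_iff.2 fun i j => ?_
    have hexp : ∀ n, Real.exp (-(s n) / 2) * Real.exp (s n / 2) = 1 := fun n => by
      rw [← Real.exp_add]; ring_nf; exact Real.exp_zero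
    fin_cases i <;> fin_cases j
    · refine tendsto_const_nhds.congr fun n => ?_
      simp [mul_apply_two, inv_apply_00, δ, mul_right_comm _ (k 1 1), hexp]
    · have : Tendsto (fun n => -(k 0 1) * Real.exp (-(s n))) atTop (𝓝 0) := by
        simpa using (Real.tendsto_exp_neg_atTop_nhds_zero.comp hst).const_mul (-(k 0 1))
      refine this.congr fun n => ?_
      simp only [mul_apply_two, inv_apply_01, inv_apply_00, inv_apply_10, inv_apply_11]
      simp only [Fin.mk_one, Fin.zero_eta, dg_00, dg_01, dg_11]
      have : Real.exp (-(s n)) = Real.exp (-(s n) / 2) * Real.exp (-(s n) / 2) := by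
        rw [← Real.exp_add]; ring_nf
      rw [this]; ring
    · refine tendsto_const_nhds.congr fun n => ?_
      simp [mul_apply_two, inv_apply_10, δ, hk]
    · refine tendsto_const_nhds.congr fun n => ?_
      simp only [mul_apply_two, inv_apply_01, inv_apply_00, inv_apply_10, inv_apply_11]
      simp only [Fin.mk_one, dg_01, dg_10, dg_11, δ]
      simp
      linear_combination -(k 0 0) * hexp n
  have h3 := h1.mul h2
  have h4 : g * δ ∈ N := by
    refine hcl.mem_of_tendsto h3 (Eventually.of_forall fun n => ?_)
    have : T n * g * dg (s n) * e n * (dg (-(s n)) * k⁻¹ * dg (s n)) =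
        T n * h * dg (s n) * e n := by
      -- The sign `e n` is central and can be moved to the end.
      have : T n * g * dg (s n) * e n * (dg (-(s n)) * k⁻¹ * dg (s n)) =
          T n * g * dg (s n) * (dg (-(s n)) * k⁻¹ * dg (s n)) * e n := by
        rcases he n with h | h <;> simp [h]
      rw [this, hkdef, ← dg_inv]
      group
    rw [this]
    refine hN.right _ ?_ _ (hN.right _ (dg_mem_Nrm _) _ (hN.left _ (hT n) _ hh))
    rcases he n with h | h <;> rw [h]
    exacts [Nrm.one_mem, neg_one_mem_Nrm]
  simpa using hN.right _ (Nrm.inv_mem hδ) _ h4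

/-- Each of the four entries vanishes exactly when one endpoint of `h` is one endpoint of the
translate of `g`. Reversing `h`, `g` or both by `weyl` makes the common endpoint the forward one,
which is why recurrence in both directions is needed. -/
lemma mem_of_recurrent_of_crossProd_eq_zero (hN : IsFlowInvariant Γ N) (hcl : IsClosed N)
    (hfwd : IsForwardRecurrent Γ g) (hbwd : IsForwardRecurrent Γ (g * weyl))
    {h γ : SL(2, ℝ)} (hh : h ∈ N) (hγ : γ ∈ flowOrbit Γ g) (hk : crossProd (h⁻¹ * γ) = 0) :
    g ∈ N := by
  obtain ⟨T, hT, q, hq, rfl⟩ := hγ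
  rw [mul_assoc T, ← mul_assoc, ← mul_assoc, crossProd_mul_right hq] at hk
  set h' := T⁻¹ * h
  have hh' : h' ∈ N := hN.left _ (Γ.inv_mem hT) _ hh
  have e : h⁻¹ * T = h'⁻¹ := by simp [h']
  rw [e] at hk
  have hw := weyl_mem_Nrm
  have back : g * weyl ∈ N → g ∈ N := fun h => by simpa using hN.right _ (Nrm.inv_mem hw) _ h
  unfold crossProd at hk
  have hinv : (h' * weyl)⁻¹ = weyl⁻¹ * h'⁻¹ := by simp
  rcases mul_eq_zero.1 hk with hk | h11
  · rcases mul_eq_zero.1 hk with hk | h10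
    · rcases mul_eq_zero.1 hk with h00 | h01
      · refine mem_of_recurrent_of_asymptotic hN hcl hfwd (hN.right _ hw _ hh') ?_
        rw [hinv, mul_assoc, mul_apply_two, h00, inv_apply_11]; simp
      · refine back (mem_of_recurrent_of_asymptotic hN hcl hbwd (hN.right _ hw _ hh') ?_)
        rw [hinv, mul_assoc, ← mul_assoc h'⁻¹, mul_apply_two, inv_apply_11, mul_apply_two, h01]
        simp
    · exact mem_of_recurrent_of_asymptotic hN hcl hfwd hh' h10
  · refine back (mem_of_recurrent_of_asymptotic hN hcl hbwd hh' ?_)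
    rw [← mul_assoc, mul_apply_two, h11]
    simp

lemma crossProd_nonneg_of_flowOrbit (hnc : ∀ T ∈ Γ, 0 ≤ crossProd (g⁻¹ * T * g))
    {x y : SL(2, ℝ)} (hx : x ∈ flowOrbit Γ g) (hy : y ∈ flowOrbit Γ g) :
    0 ≤ crossProd (x⁻¹ * y) := by
  obtain ⟨T, hT, q, hq, rfl⟩ := hx
  obtain ⟨T', hT', q', hq', rfl⟩ := hy
  have : (T * g * q)⁻¹ * (T' * g * q') = q⁻¹ * (g⁻¹ * (T⁻¹ * T') * g) * q' := by group
  rw [this, crossProd_mul_right hq', crossProd_mul_left (Nrm.inv_mem hq)]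
  exact hnc _ (Γ.mul_mem (Γ.inv_mem hT) hT')

lemma crossProd_nonneg_of_closure (hnc : ∀ T ∈ Γ, 0 ≤ crossProd (g⁻¹ * T * g))
    {x y : SL(2, ℝ)} (hx : x ∈ closure (flowOrbit Γ g)) (hy : y ∈ closure (flowOrbit Γ g)) :
    0 ≤ crossProd (x⁻¹ * y) := by
  have hc : Continuous (Function.uncurry fun x y : SL(2, ℝ) => crossProd (x⁻¹ * y)) :=
    continuous_crossProd.comp (continuous_fst.inv.mul continuous_snd)
  have := map_mem_closure₂ hc (u := Ici (0 : ℝ)) hx hy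
    fun a ha b hb => crossProd_nonneg_of_flowOrbit hnc ha hb
  rwa [isClosed_Ici.closure_eq] at this

/-! ### Thin strips between disjoint geodesics -/

/-- After turning around one of the geodesics, or both, the matrix of a pair of geodesics which
neither cross nor are asymptotic has positive entries. -/
lemma exists_entries_pos {k : SL(2, ℝ)} (hk : 0 < crossProd k) :
    ∃ q ∈ Nrm, ∃ q' ∈ Nrm, q • I = I ∧ q' • I = I ∧
      0 < (q⁻¹ * k * q') 0 0 ∧ 0 < (q⁻¹ * k * q') 0 1 ∧
      0 < (q⁻¹ * k * q') 1 0 ∧ 0 < (q⁻¹ * k * q') 1 1 := by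
  have hw := weyl_mem_Nrm
  have hwI := weyl_smul_I
  have key : ∀ k : SL(2, ℝ), 0 < crossProd k → 0 < k 0 0 → 0 < k 1 1 →
    ∃ q ∈ Nrm, ∃ q' ∈ Nrm, q • I = I ∧ q' • I = I ∧
      0 < (q⁻¹ * k * q') 0 0 ∧ 0 < (q⁻¹ * k * q') 0 1 ∧
      0 < (q⁻¹ * k * q') 1 0 ∧ 0 < (q⁻¹ * k * q') 1 1 := by
    intro k hk h0 h1
    have hbc : 0 < k 0 1 * k 1 0 := by
      have : crossProd k = (k 0 0 * k 1 1) * (k 0 1 * k 1 0) := by unfold crossProd; ring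
      rw [this] at hk
      exact (mul_pos_iff_of_pos_left (mul_pos h0 h1)).1 hk
    rcases lt_or_ge 0 (k 0 1) with hb | hb
    · exact ⟨1, Nrm.one_mem, 1, Nrm.one_mem, by simp, by simp, by simpa,
        by simpa, by simpa using (mul_pos_iff_of_pos_left hb).1 hbc, by simpa⟩
    · have hb' : k 0 1 < 0 := lt_of_le_of_ne hb fun h => by simp [h] at hbc
      have hc' : k 1 0 < 0 := neg_of_mul_pos_right hbc hb'.le
      -- Conjugation by `weyl` swaps the diagonal entries and swaps and negates the off-diagonal
      -- ones.
      refine ⟨weyl, hw, weyl, hw, hwI, hwI, ?_, ?_, ?_, ?_⟩ <;>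
        simp [mul_apply_two, inv_apply_00, inv_apply_01, inv_apply_10, inv_apply_11, *]
  have key2 : ∀ q₀ ∈ Nrm, q₀ • I = I → 0 < (k * q₀) 0 0 → 0 < (k * q₀) 1 1 →
    ∃ q ∈ Nrm, ∃ q' ∈ Nrm, q • I = I ∧ q' • I = I ∧
      0 < (q⁻¹ * k * q') 0 0 ∧ 0 < (q⁻¹ * k * q') 0 1 ∧
      0 < (q⁻¹ * k * q') 1 0 ∧ 0 < (q⁻¹ * k * q') 1 1 := by
    intro q₀ hq₀ hI h0 h1
    obtain ⟨q, hq, q', hq', h1, h2, h3⟩ := key (k * q₀) (by rwa [crossProd_mul_right hq₀]) h0 h1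
    refine ⟨q, hq, q₀ * q', Nrm.mul_mem hq₀ hq', h1, by rw [mul_smul, h2, hI], ?_⟩
    simpa only [mul_assoc] using h3
  have hd := det_eq k
  have hP : crossProd k = (k 0 0 * k 1 1) * (k 0 1 * k 1 0) := by unfold crossProd; ring
  rw [hP] at hk
  have hn : (-1 : SL(2, ℝ)) • I = I := by rw [neg_smul_pt, one_smul]
  have hnw : (-weyl : SL(2, ℝ)) • I = I := by rw [neg_smul_pt, hwI]
  have hnw' : -weyl ∈ Nrm := Or.inr (by simp)
  rcases pos_and_pos_or_neg_and_neg_of_mul_pos hk with ⟨h1, h2⟩ | ⟨h1, h2⟩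
  · rcases pos_and_pos_or_neg_and_neg_of_mul_pos h1 with ⟨h3, h4⟩ | ⟨h3, h4⟩
    · exact key2 1 Nrm.one_mem (by simp) (by simpa) (by simpa)
    · exact key2 (-1) neg_one_mem_Nrm hn (by simpa) (by simpa)
  · rcases mul_neg_iff.1 h2 with ⟨h3, h4⟩ | ⟨h3, h4⟩
    · exact key2 weyl hw hwI (by simpa [mul_apply_two]) (by simpa [mul_apply_two])
    · exact key2 (-weyl) hnw' hnw (by simpa [mul_apply_two]) (by simpa [mul_apply_two])

lemma normSq_rot_invariant {k q q' : SL(2, ℝ)} (hq : q • I = I) (hq' : q' • I = I) :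
    normSq (q⁻¹ * k * q') = normSq k := by
  rw [← two_cosh_dist_smul_I, ← two_cosh_dist_smul_I, mul_smul, hq', mul_smul]
  nth_rewrite 2 [show I = q⁻¹ • I by rw [eq_inv_smul_iff, hq]]
  rw [dist_smul]

/-- The set of base points of a closed set of unit tangent vectors contains a point nearest to a
given point. -/
lemma exists_nearest (hcl : IsClosed N) (hne : N.Nonempty) (p : ℍ) :
    ∃ h ∈ N, ∀ h' ∈ N, dist (h • I) p ≤ dist (h' • I) p := by
  obtain ⟨h₀, hh₀⟩ := hne
  have hK : IsCompact (N ∩ (fun h : SL(2, ℝ) => h • I) ⁻¹' Metric.closedBall p (dist (h₀ • I) p)) :=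
    (UpperHalfPlane.isProperMap_smul_I.isCompact_preimage
      (isCompact_closedBall _ _)).inter_left hcl
  have hc : Continuous fun h : SL(2, ℝ) => dist (h • I) p := by fun_prop
  obtain ⟨h, hh, hmin⟩ := hK.exists_isMinOn ⟨h₀, hh₀, by simp⟩ hc.continuousOn
  refine ⟨h, hh.1, fun h' hh' => ?_⟩
  by_cases hle : dist (h' • I) p ≤ dist (h₀ • I) p
  · exact hmin ⟨hh', hle⟩
  · exact (Metric.mem_closedBall.1 hh.2).trans (not_le.1 hle).le

/-- If the closed set `N` accumulates on the geodesic `g`, then there are translates of `g` which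
are close to a nearest element of `N` and lie on one side of it. -/
lemma exists_close_pair (hN : IsFlowInvariant Γ N) (hcl : IsClosed N) (hne : N.Nonempty)
    (hsub : N ⊆ closure (flowOrbit Γ g)) (hpos : ∀ h ∈ N, ∀ γ ∈ flowOrbit Γ g,
      0 < crossProd (h⁻¹ * γ)) {ε : ℝ} (hε : 0 < ε) :
    ∃ h ∈ N, ∃ γ ∈ flowOrbit Γ g, (∀ h' ∈ N, dist (h • I) (γ • I) ≤ dist (h' • I) (γ • I)) ∧
      (∀ i j, 0 < (h⁻¹ * γ) i j) ∧ normSq (h⁻¹ * γ) < 2 + ε := by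
  obtain ⟨h₀, hh₀⟩ := hne
  have hcont : Continuous fun γ : SL(2, ℝ) => normSq (h₀⁻¹ * γ) := by
    unfold normSq; fun_prop
  have hopen : IsOpen {γ : SL(2, ℝ) | normSq (h₀⁻¹ * γ) < 2 + ε} :=
    isOpen_lt hcont continuous_const
  obtain ⟨γ₀, (hγ₀' : normSq (h₀⁻¹ * γ₀) < 2 + ε), hγ₀⟩ := mem_closure_iff.1 (hsub hh₀) _ hopen
    (by rw [mem_ofPred_eq, inv_mul_cancel, show normSq 1 = 2 by norm_num [normSq]]; linarith)
  -- The approximated `h₀` is replaced by an element of `N` nearest to `γ₀`: it is at least as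
  -- close, and minimality keeps other geodesics of `N` out of the strip.
  obtain ⟨h₁, hh₁, hmin⟩ := exists_nearest hcl ⟨h₀, hh₀⟩ (γ₀ • I)
  obtain ⟨q, hq, q', hq', hqI, hqI', h00, h01, h10, h11⟩ := exists_entries_pos (hpos h₁ hh₁ γ₀ hγ₀)
  have e : (h₁ * q)⁻¹ * (γ₀ * q') = q⁻¹ * (h₁⁻¹ * γ₀) * q' := by group
  refine ⟨h₁ * q, hN.right _ hq _ hh₁, γ₀ * q',
    (isFlowInvariant_flowOrbit Γ g).right _ hq' _ hγ₀, ?_, ?_, ?_⟩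
  · intro h' hh'
    rw [mul_smul, hqI, mul_smul, hqI']
    exact hmin h' hh'
  · rw [e]
    intro i j
    fin_cases i <;> fin_cases j
    exacts [h00, h01, h10, h11]
  · rw [e, normSq_rot_invariant hqI hqI']
    refine lt_of_le_of_lt ?_ hγ₀'
    rw [← two_cosh_dist_smul_smul, ← two_cosh_dist_smul_smul, dist_comm, dist_comm _ (h₀ • I)]
    have := hmin h₀ hh₀
    rw [← abs_of_nonneg (dist_nonneg (x := h₁ • I)), ← abs_of_nonneg (dist_nonneg (x := h₀ • I))]
      at this
    have := Real.cosh_le_cosh.2 this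
    linarith

/-- For determinant one, `normSq k - 2` equals `(k 0 0 - k 1 1) ^ 2 + (k 0 1 + k 1 0) ^ 2`.
Positivity turns the bound on the sum `k 0 1 + k 1 0` into a bound on each summand. -/
lemma entries_close_to_one {k : SL(2, ℝ)} {ε : ℝ} (hpos : ∀ i j, 0 < k i j)
    (hk : normSq k < 2 + ε ^ 2) (hε : 0 < ε) (hε1 : ε < 1) :
    |k 0 0 - 1| < 2 * ε ∧ |k 1 1 - 1| < 2 * ε ∧ k 0 1 < ε ∧ k 1 0 < ε := by
  have hd := det_eq k
  have h00 := hpos 0 0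
  have h01 := hpos 0 1
  have h10 := hpos 1 0
  have h11 := hpos 1 1
  unfold normSq at hk
  have e : (k 0 0 - k 1 1) ^ 2 + (k 0 1 + k 1 0) ^ 2 < ε ^ 2 := by nlinarith
  have h1 : k 0 1 + k 1 0 < ε := lt_of_pow_lt_pow_left₀ 2 hε.le (by nlinarith [sq_nonneg (k 0 0 - k 1 1)])
  have h2 : |k 0 0 - k 1 1| < ε := abs_lt_of_sq_lt_sq (by nlinarith [sq_nonneg (k 0 1 + k 1 0)]) hε.le
  rw [abs_lt] at h2
  have h3 : 1 ≤ k 0 0 * k 1 1 := by nlinarith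
  have h4 : k 0 0 * k 1 1 < 1 + ε ^ 2 := by nlinarith
  refine ⟨?_, ?_, by linarith, by linarith⟩ <;> rw [abs_lt] <;> constructor <;> nlinarith

lemma smul_I_re_neg {k : SL(2, ℝ)} (h : k 0 0 * k 1 0 + k 0 1 * k 1 1 < 0) : (k • I).re < 0 := by
  rw [smul_I_re]; exact div_neg_of_neg_of_pos h (denom_sq_pos k)

lemma smul_I_re_nonneg {k : SL(2, ℝ)} (h : 0 ≤ k 0 0 * k 1 0 + k 0 1 * k 1 1) :
    0 ≤ (k • I).re := by
  rw [smul_I_re]; exact div_nonneg h (denom_sq_pos k).le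

/-- A geodesic which separates two points contains a point of the open segment between them. -/
lemma exists_dist_lt_of_separates {z w : ℍ} {y : SL(2, ℝ)} (h1 : (y⁻¹ • z).re < 0)
    (h2 : 0 ≤ (y⁻¹ • w).re) : ∃ t, dist (geo y t) w < dist z w := by
  obtain ⟨u, hu0, hu1⟩ := exists_geo_joining z w
  have hc : Continuous fun t => (y⁻¹ • geo u t).re :=
    UpperHalfPlane.continuous_re.comp ((isometry_geo u).continuous.const_smul _)
  obtain ⟨t, ht, ht0⟩ := intermediate_value_Icc (a := 0) (b := dist z w) dist_nonneg
    hc.continuousOn (show (0 : ℝ) ∈ _ from ⟨by rw [hu0]; exact h1.le, by rw [hu1]; exact h2⟩)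
  have ht0' : (y⁻¹ • geo u t).re = 0 := ht0
  -- Strictness of `h1` keeps the crossing point away from `z`; it may coincide with `w`.
  have hpos : 0 < t := by
    refine lt_of_le_of_ne ht.1 fun h => ?_
    rw [← h, hu0] at ht0'
    exact h1.ne ht0'
  have he := eq_dg_smul_of_re_eq_zero ht0'
  rw [inv_smul_eq_iff, smul_smul, ← geo_def] at he
  refine ⟨Real.log (y⁻¹ • geo u t).im, ?_⟩
  rw [← he]
  nth_rewrite 1 [← hu1]
  rw [dist_geo, abs_sub_comm, abs_of_nonneg (sub_nonneg.2 ht.2)]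
  linarith

/-- This conjugate is the relative position of two unit tangent vectors after both have flowed for
time `s`. The lower left entry measures the separation of the forward endpoints, the upper right one
that of the backward endpoints. -/
lemma conj_dg_00 (k : SL(2, ℝ)) (s : ℝ) : (dg (-s) * k * dg s) 0 0 = k 0 0 := by
  simp only [mul_apply_two, dg_00, dg_01, dg_10]
  have : Real.exp (-s / 2) * Real.exp (s / 2) = 1 := by
    rw [← Real.exp_add, neg_div, neg_add_cancel, Real.exp_zero]
  linear_combination k 0 0 * this

lemma conj_dg_01 (k : SL(2, ℝ)) (s : ℝ) :
    (dg (-s) * k * dg s) 0 1 = k 0 1 * Real.exp (-s) := by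
  simp only [mul_apply_two, dg_00, dg_01, dg_11]
  have : Real.exp (-s / 2) * Real.exp (-s / 2) = Real.exp (-s) := by
    rw [← Real.exp_add, add_halves]
  linear_combination k 0 1 * this

lemma conj_dg_10 (k : SL(2, ℝ)) (s : ℝ) :
    (dg (-s) * k * dg s) 1 0 = k 1 0 * Real.exp s := by
  simp only [mul_apply_two, dg_00, dg_10, dg_11, neg_neg]
  have : Real.exp (s / 2) * Real.exp (s / 2) = Real.exp s := by
    rw [← Real.exp_add, add_halves]
  linear_combination k 1 0 * this

lemma conj_dg_11 (k : SL(2, ℝ)) (s : ℝ) : (dg (-s) * k * dg s) 1 1 = k 1 1 := by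
  simp only [mul_apply_two, dg_01, dg_10, dg_11, neg_neg]
  have : Real.exp (-s / 2) * Real.exp (s / 2) = 1 := by
    rw [← Real.exp_add, neg_div, neg_add_cancel, Real.exp_zero]
  linear_combination k 1 1 * this

/-- The endpoints `m 0 0 / m 1 0` and `m 0 1 / m 1 1` lie in `[0, ∞]` and differ from the pair `∞`,
`0`, so the vertical geodesic lies strictly on the negative side of the geodesic of `m`. -/
lemma re_inv_mul_dg_neg {m : SL(2, ℝ)} {s : ℝ} (h00 : 0 < m 0 0) (h11 : 0 < m 1 1)
    (h01 : 0 ≤ m 0 1) (h10 : 0 ≤ m 1 0) (hne : ¬(m 0 1 = 0 ∧ m 1 0 = 0)) :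
    ((m⁻¹ * dg (-s)) • I).re < 0 := by
  apply smul_I_re_neg
  simp only [mul_apply_two, inv_apply_00, inv_apply_01, inv_apply_10, inv_apply_11, dg_00,
    dg_01, dg_10, dg_11, mul_zero, zero_add, add_zero]
  generalize hE : Real.exp (-s / 2) = E
  generalize hE' : Real.exp (-(-s) / 2) = E'
  have hEp : 0 < E := hE ▸ Real.exp_pos _
  have hEp' : 0 < E' := hE' ▸ Real.exp_pos _
  have t1 : 0 ≤ (m 1 1 * E ^ 2) * m 1 0 := by positivity
  have t2 : 0 ≤ (m 0 0 * E' ^ 2) * m 0 1 := by positivity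
  have t3 : 0 < (m 1 1 * E ^ 2) * m 1 0 + (m 0 0 * E' ^ 2) * m 0 1 := by
    refine lt_of_le_of_ne (add_nonneg t1 t2) fun h0 => hne ?_
    have h1 := (add_eq_zero_iff_of_nonneg t1 t2).1 h0.symm
    have hc1 : m 1 1 * E ^ 2 ≠ 0 := by positivity
    have hc2 : m 0 0 * E' ^ 2 ≠ 0 := by positivity
    exact ⟨(mul_eq_zero.1 h1.2).resolve_left hc2, (mul_eq_zero.1 h1.1).resolve_left hc1⟩
  linarith

lemma re_mul_dg_nonneg {r : SL(2, ℝ)} {s : ℝ} (h00 : 0 ≤ r 0 0) (h01 : 0 ≤ r 0 1)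
    (h10 : 0 ≤ r 1 0) (h11 : 0 ≤ r 1 1) : 0 ≤ ((r * dg s) • I).re := by
  apply smul_I_re_nonneg
  simp only [mul_apply_two r, dg_00, dg_01, dg_10, dg_11, mul_zero, zero_add, add_zero]
  positivity

/-- Translates under `Γ` of points of nearest geodesics, taken where the nearby geodesics have
diverged by a definite amount, can only accumulate by lying on one and the same geodesic. -/
lemma eventually_same_geodesic (hN : IsFlowInvariant Γ N) {h γ T : ℕ → SL(2, ℝ)} {s : ℕ → ℝ}
    {x κ : SL(2, ℝ)} (hh : ∀ n, h n ∈ N) (hT : ∀ n, T n ∈ Γ)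
    (hmin : ∀ n, ∀ h' ∈ N, dist (h n • I) (γ n • I) ≤ dist (h' • I) (γ n • I))
    (hncN : ∀ a ∈ N, ∀ b ∈ N, 0 ≤ crossProd (a⁻¹ * b))
    (hncγ : ∀ a ∈ N, ∀ n, 0 ≤ crossProd (a⁻¹ * γ n))
    (hx : Tendsto (fun n => T n * h n * dg (s n)) atTop (𝓝 x))
    (hκ : Tendsto (fun n => dg (-(s n)) * ((h n)⁻¹ * γ n) * dg (s n)) atTop (𝓝 κ))
    (h00 : κ 0 0 = 1) (h11 : κ 1 1 = 1) (hκ' : 0 < κ 1 0 ∨ 0 < κ 0 1) :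
    ∀ᶠ n₀ in atTop, ∀ n ≥ n₀, ∃ o, |o| ≤ 2 ∧
      T n * h n * dg (s n) = T n₀ * h n₀ * dg (s n₀) * dg o := by
  set X : ℕ → SL(2, ℝ) := fun n => T n * h n * dg (s n) with hX
  set K : ℕ → SL(2, ℝ) := fun n => dg (-(s n)) * ((h n)⁻¹ * γ n) * dg (s n) with hK
  have hm : Tendsto (fun p : ℕ × ℕ => (X p.1)⁻¹ * X p.2) (atTop ×ˢ atTop) (𝓝 1) := by
    have := (hx.comp (tendsto_fst (g := atTop))).inv.mul (hx.comp (tendsto_snd (f := atTop)))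
    rwa [inv_mul_cancel] at this
  have hr : Tendsto (fun p : ℕ × ℕ => ((X p.1)⁻¹ * X p.2)⁻¹ * K p.1) (atTop ×ˢ atTop) (𝓝 κ) := by
    simpa using hm.inv.mul (hκ.comp (tendsto_fst (g := atTop)))
  have ev : ∀ {u : ℕ × ℕ → SL(2, ℝ)} {a : SL(2, ℝ)} (_ : Tendsto u (atTop ×ˢ atTop) (𝓝 a))
      (i j : Fin 2) (b : ℝ) (_ : b < a i j), ∀ᶠ p in atTop ×ˢ atTop, b < u p i j :=
    fun hu i j b hb => (tendsto_SL_iff.1 hu i j).eventually_const_lt hb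
  have hev : ∀ᶠ p : ℕ × ℕ in atTop ×ˢ atTop,
      (1 / 2 < ((X p.1)⁻¹ * X p.2) 0 0 ∧ ((X p.1)⁻¹ * X p.2) 0 0 < 2 ∧
        0 < ((X p.1)⁻¹ * X p.2) 1 1) ∧
      0 < (((X p.1)⁻¹ * X p.2)⁻¹ * K p.1) 0 0 ∧ 0 < (((X p.1)⁻¹ * X p.2)⁻¹ * K p.1) 1 1 ∧
      (0 < (((X p.1)⁻¹ * X p.2)⁻¹ * K p.1) 1 0 ∨ 0 < (((X p.1)⁻¹ * X p.2)⁻¹ * K p.1) 0 1) := by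
    refine ((ev hm 0 0 _ (by norm_num)).and
      (((tendsto_SL_iff.1 hm 0 0).eventually_lt_const (by norm_num)).and
        (ev hm 1 1 0 (by norm_num)))).and
      ((ev hr 0 0 0 (by rw [h00]; norm_num)).and ((ev hr 1 1 0 (by rw [h11]; norm_num)).and ?_))
    rcases hκ' with h | h
    · exact (ev hr 1 0 0 h).mono fun _ h => Or.inl h
    · exact (ev hr 0 1 0 h).mono fun _ h => Or.inr h
  rw [prod_atTop_atTop_eq] at hev
  obtain ⟨n₁, hn₁⟩ := eventually_atTop_prod_self.1 hev
  -- The geodesic of `X p` cannot lie strictly on the positive side of the one of `X n`.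
  have claim : ∀ n ≥ n₁, ∀ p ≥ n₁, 0 ≤ ((X n)⁻¹ * X p) 0 1 → 0 ≤ ((X n)⁻¹ * X p) 1 0 →
      ((X n)⁻¹ * X p) 0 1 = 0 ∧ ((X n)⁻¹ * X p) 1 0 = 0 := by
    intro n hn p hp h01 h10
    obtain ⟨⟨ha, -, hd⟩, hr00, hr11, hr'⟩ := hn₁ n p hn hp
    by_contra hne
    set m := (X n)⁻¹ * X p with hmdef
    set r := m⁻¹ * K n with hrdef
    set y := (T n)⁻¹ * X p with hydef
    -- `y` is the geodesic of `X p` carried back to the strip between `h n` and `γ n`; it is shown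
    -- to separate the two base points, against the minimality of `h n`.
    have hy : y ∈ N := hN.left _ (Γ.inv_mem (hT n)) _
      (hN.right _ (dg_mem_Nrm _) _ (hN.left _ (hT p) _ (hh p)))
    have e1 : y⁻¹ * h n = m⁻¹ * dg (-(s n)) := by
      simp only [hydef, hmdef, hX, ← dg_inv]; group
    have e2 : y⁻¹ * γ n = r * dg (-(s n)) := by
      simp only [hrdef, hmdef, hK, hydef, hX, ← dg_inv]; group
    have hP : 0 ≤ crossProd r := by
      have := hncγ y hy n
      rwa [e2, crossProd_mul_right (dg_mem_Nrm _)] at this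
    have hP' : 0 ≤ r 0 1 * r 1 0 := by
      have : crossProd r = (r 0 0 * r 1 1) * (r 0 1 * r 1 0) := by unfold crossProd; ring
      rw [this] at hP
      exact nonneg_of_mul_nonneg_right hP (mul_pos hr00 hr11)
    -- The limit `κ` controls the sign of only one off-diagonal entry; absence of crossings supplies
    -- the other.
    have hr01 : 0 ≤ r 0 1 ∧ 0 ≤ r 1 0 := by
      rcases hr' with h | h
      · exact ⟨nonneg_of_mul_nonneg_left hP' h, h.le⟩
      · exact ⟨h.le, nonneg_of_mul_nonneg_right hP' h⟩
    obtain ⟨t, ht⟩ := exists_dist_lt_of_separates (z := h n • I) (w := γ n • I) (y := y)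
      (by rw [smul_smul, e1]; exact re_inv_mul_dg_neg (by linarith) hd h01 h10 hne)
      (by rw [smul_smul, e2]; exact re_mul_dg_nonneg hr00.le hr01.1 hr01.2 hr11.le)
    exact absurd (hmin n _ (hN.right _ (dg_mem_Nrm t) _ hy)) (not_le.2 ht)
  filter_upwards [eventually_ge_atTop n₁] with n₀ hn₀ n hn
  have hn' := hn₀.trans hn
  obtain ⟨⟨ha, ha2, hd⟩, -⟩ := hn₁ n₀ n hn₀ hn'
  have hinv : (X n)⁻¹ * X n₀ = ((X n₀)⁻¹ * X n)⁻¹ := by group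
  have c1 := claim n₀ hn₀ n hn'
  have c2 := claim n hn' n₀ hn₀
  rw [hinv, inv_apply_01, inv_apply_10] at c2
  set m := (X n₀)⁻¹ * X n with hmdef
  have hP : 0 ≤ m 0 1 * m 1 0 := by
    have hXN : ∀ n, X n ∈ N := fun n =>
      hN.right _ (dg_mem_Nrm _) _ (hN.left _ (hT n) _ (hh n))
    have h := hncN _ (hXN n₀) _ (hXN n)
    have : crossProd m = (m 0 0 * m 1 1) * (m 0 1 * m 1 0) := by unfold crossProd; ring
    rw [← hmdef, this] at h
    exact nonneg_of_mul_nonneg_right h (mul_pos (by linarith) hd)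
  -- Geodesics of `N` do not cross, so one of the two lies on the positive side of the other, and
  -- `claim` applies in one order or the other.
  have hz : m 0 1 = 0 ∧ m 1 0 = 0 := by
    rcases mul_nonneg_iff.1 hP with ⟨h1, h2⟩ | ⟨h1, h2⟩
    · exact c1 h1 h2
    · simpa using c2 (by linarith) (by linarith)
  have ha' : 0 < m 0 0 := by linarith
  refine ⟨2 * Real.log (m 0 0), ?_, ?_⟩
  · have l1 := Real.log_le_sub_one_of_pos ha'
    have l2 := Real.one_sub_inv_le_log_of_pos ha'
    have : (m 0 0)⁻¹ < 2 := by rw [inv_lt_comm₀ ha' two_pos]; linarith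
    rw [abs_le]; constructor <;> linarith
  · rw [← eq_dg hz.1 hz.2 ha', hmdef, mul_inv_cancel_left]

/-- Compares the geodesic of `k` with its image under the translation by `t` along the vertical
axis. When all entries of `k` are positive, the last two factors have positive product exactly if
`exp |t|` is less than the ratio `k 0 0 * k 1 1 / (k 0 1 * k 1 0)` of the endpoints; for `t ≠ 0` the
endpoints then interlace and the geodesics cross. -/
lemma crossProd_inv_mul_dg_mul (k : SL(2, ℝ)) (t : ℝ) :
    crossProd (k⁻¹ * dg t * k) = -(k 0 0 * k 0 1 * k 1 0 * k 1 1 *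
      (Real.exp (t / 2) - Real.exp (-t / 2)) ^ 2 *
      ((Real.exp (t / 2) * (k 0 0 * k 1 1) - Real.exp (-t / 2) * (k 0 1 * k 1 0)) *
      (Real.exp (-t / 2) * (k 0 0 * k 1 1) - Real.exp (t / 2) * (k 0 1 * k 1 0)))) := by
  simp only [crossProd, mul_apply_two, inv_apply_00, inv_apply_01, inv_apply_10, inv_apply_11,
    dg_00, dg_01, dg_10, dg_11]
  ring

/-- There is no sequence of nearest pairs of disjoint, non asymptotic geodesics as provided by
`exists_close_pair` which become closer and closer: otherwise the two ends of the strips between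
them produce a closed geodesic in `N` and a crossing of two translates of `g`. -/
lemma false_of_close_pairs (hnc : ∀ T ∈ Γ, 0 ≤ crossProd (g⁻¹ * T * g))
    (hN : IsFlowInvariant Γ N) {h γ T S : ℕ → SL(2, ℝ)} {x x' : SL(2, ℝ)}
    (hh : ∀ n, h n ∈ N) (hγ : ∀ n, γ n ∈ flowOrbit Γ g) (hT : ∀ n, T n ∈ Γ) (hS : ∀ n, S n ∈ Γ)
    (hmin : ∀ n, ∀ h' ∈ N, dist (h n • I) (γ n • I) ≤ dist (h' • I) (γ n • I))
    (hncN : ∀ a ∈ N, ∀ b ∈ N, 0 ≤ crossProd (a⁻¹ * b))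
    (hncγ : ∀ a ∈ N, ∀ n, 0 ≤ crossProd (a⁻¹ * γ n))
    {k : ℕ → SL(2, ℝ)} {s s' : ℕ → ℝ} (hk : ∀ n, (h n)⁻¹ * γ n = k n)
    (hs : ∀ n, s n = -Real.log (k n 1 0)) (hs' : ∀ n, s' n = Real.log (k n 0 1))
    (hent : ∀ n i j, 0 < k n i j)
    (h00 : Tendsto (fun n => k n 0 0) atTop (𝓝 1)) (h11 : Tendsto (fun n => k n 1 1) atTop (𝓝 1))
    (h01 : Tendsto (fun n => k n 0 1) atTop (𝓝 0)) (h10 : Tendsto (fun n => k n 1 0) atTop (𝓝 0))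
    (hx : Tendsto (fun n => T n * h n * dg (s n)) atTop (𝓝 x))
    (hx' : Tendsto (fun n => S n * h n * dg (s' n)) atTop (𝓝 x')) :
    False := by
  have hmul : Tendsto (fun n => k n 0 1 * k n 1 0) atTop (𝓝 0) := by simpa using h01.mul h10
  have hes : ∀ n, Real.exp (s n) = (k n 1 0)⁻¹ ∧ Real.exp (-(s n)) = k n 1 0 := fun n => by
    rw [hs, neg_neg, Real.exp_neg, Real.exp_log (hent n 1 0)]; exact ⟨rfl, rfl⟩
  have hes' : ∀ n, Real.exp (s' n) = k n 0 1 ∧ Real.exp (-(s' n)) = (k n 0 1)⁻¹ := fun n => by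
    rw [hs', Real.exp_neg, Real.exp_log (hent n 0 1)]; exact ⟨rfl, rfl⟩
  have c00 : ∀ n, (dg (-(s n)) * k n * dg (s n)) 0 0 = k n 0 0 := fun n => conj_dg_00 _ _
  have c11 : ∀ n, (dg (-(s n)) * k n * dg (s n)) 1 1 = k n 1 1 := fun n => conj_dg_11 _ _
  have c01 : ∀ n, (dg (-(s n)) * k n * dg (s n)) 0 1 = k n 0 1 * k n 1 0 := fun n => by
    rw [conj_dg_01, (hes n).2]
  have c10 : ∀ n, (dg (-(s n)) * k n * dg (s n)) 1 0 = 1 := fun n => by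
    rw [conj_dg_10, (hes n).1, mul_inv_cancel₀ (hent n 1 0).ne']
  -- The times `s n` and `s' n` are those at which the growing off-diagonal entry has reached
  -- exactly 1, so the pair converges to two distinct geodesics with one common endpoint.
  let κ : SL(2, ℝ) := ⟨!![1, 0; 1, 1], by simp [Matrix.det_fin_two_of]⟩
  let κ' : SL(2, ℝ) := ⟨!![1, 1; 0, 1], by simp [Matrix.det_fin_two_of]⟩
  have hκ : Tendsto (fun n => dg (-(s n)) * k n * dg (s n)) atTop (𝓝 κ) := by
    refine tendsto_SL_iff.2 fun i j => ?_
    fin_cases i <;> fin_cases j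
    · exact h00.congr fun n => (c00 n).symm
    · exact hmul.congr fun n => (c01 n).symm
    · exact tendsto_const_nhds.congr fun n => (c10 n).symm
    · exact h11.congr fun n => (c11 n).symm
  have hκ' : Tendsto (fun n => dg (-(s' n)) * k n * dg (s' n)) atTop (𝓝 κ') := by
    refine tendsto_SL_iff.2 fun i j => ?_
    fin_cases i <;> fin_cases j
    · exact h00.congr fun n => (conj_dg_00 _ _).symm
    · refine tendsto_const_nhds.congr fun n => Eq.symm ?_
      refine (conj_dg_01 _ _).trans ?_
      rw [(hes' n).2, mul_inv_cancel₀ (hent n 0 1).ne']; rfl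
    · refine hmul.congr fun n => Eq.symm ?_
      refine (conj_dg_10 _ _).trans ?_
      rw [(hes' n).1, mul_comm]
    · exact h11.congr fun n => (conj_dg_11 _ _).symm
  have r1 := eventually_same_geodesic hN hh hT hmin hncN hncγ hx (by simpa only [hk] using hκ) rfl rfl (Or.inl one_pos)
  have r2 := eventually_same_geodesic hN hh hS hmin hncN hncγ hx' (by simpa only [hk] using hκ') rfl rfl (Or.inr one_pos)
  obtain ⟨n₀, hr1, hr2⟩ := (r1.and r2).exists
  have hlog1 : Tendsto s atTop atTop := funext hs ▸ tendsto_neg_atBot_atTop.comp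
    (Real.tendsto_log_nhdsGT_zero.comp (tendsto_nhdsWithin_iff.2
      ⟨h10, Eventually.of_forall fun n => hent n 1 0⟩))
  have hlog2 : Tendsto s' atTop atBot := funext hs' ▸ Real.tendsto_log_nhdsGT_zero.comp
    (tendsto_nhdsWithin_iff.2 ⟨h01, Eventually.of_forall fun n => hent n 0 1⟩)
  -- The margin 5 beats `|o| + |o'| ≤ 4`, so that the translation length below cannot vanish.
  obtain ⟨n₁, hn₁, hn₁1, hn₁2⟩ := ((eventually_ge_atTop n₀).and
    ((hlog1.eventually_ge_atTop (s n₀)).and (hlog2.eventually_le_atBot (s' n₀ - 5)))).exists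
  -- the covering transformation relating the two ends of two strips
  set y := T n₀ * h n₀ * dg (s n₀) with hy
  set y' := S n₀ * h n₀ * dg (s' n₀) with hy'
  obtain ⟨o, ho, heo⟩ := hr1 n₁ hn₁
  obtain ⟨o', ho', heo'⟩ := hr2 n₁ hn₁
  set B := T n₁ * (S n₁)⁻¹ * (T n₀ * (S n₀)⁻¹)⁻¹ with hB
  have hBΓ : B ∈ Γ := Γ.mul_mem (Γ.mul_mem (hT _) (Γ.inv_mem (hS _)))
    (Γ.inv_mem (Γ.mul_mem (hT _) (Γ.inv_mem (hS _))))
  -- The strips `n₀` and `n₁` leave along the geodesic of `y` and arrive along that of `y'`, but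
  -- have different lengths; going out along one and back along the other is a translation along
  -- `y`.
  obtain ⟨t, ht, hBy⟩ : ∃ t, t ≠ 0 ∧ B * y = y * dg t := by
    refine ⟨o - s n₁ + s' n₁ - o' - s' n₀ + s n₀, ?_, ?_⟩
    · rw [abs_le] at ho ho'
      intro h0
      linarith
    · have e1 : T n₁ = y * dg o * (dg (s n₁))⁻¹ * (h n₁)⁻¹ := by rw [← heo]; group
      have e2 : S n₁ = y' * dg o' * (dg (s' n₁))⁻¹ * (h n₁)⁻¹ := by rw [← heo']; group
      have e3 : T n₀ = y * (dg (s n₀))⁻¹ * (h n₀)⁻¹ := by rw [hy]; group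
      have e4 : S n₀ = y' * (dg (s' n₀))⁻¹ * (h n₀)⁻¹ := by rw [hy']; group
      have e5 : B * y = y * (dg o * (dg (s n₁))⁻¹ * dg (s' n₁) * (dg o')⁻¹ * (dg (s' n₀))⁻¹
          * dg (s n₀)) := by
        rw [hB, e1, e2, e3, e4]
        generalize y = a
        generalize y' = b
        group
      rw [e5]
      simp only [dg_inv, ← dg_add]
      ring_nf
  have hne : (Real.exp (t / 2) - Real.exp (-t / 2)) ^ 2 ≠ 0 := by
    refine pow_ne_zero 2 (sub_ne_zero.2 fun h0 => ht ?_)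
    have := Real.exp_injective h0
    linarith
  have hlimE : Tendsto (fun n =>
      (Real.exp (t / 2) * (k n 0 0 * k n 1 1) - Real.exp (-t / 2) * (k n 0 1 * k n 1 0)) *
      (Real.exp (-t / 2) * (k n 0 0 * k n 1 1) - Real.exp (t / 2) * (k n 0 1 * k n 1 0)))
      atTop (𝓝 1) := by
    have hprod := h00.mul h11
    have := ((hprod.const_mul (Real.exp (t / 2))).sub (hmul.const_mul (Real.exp (-t / 2)))).mul
      ((hprod.const_mul (Real.exp (-t / 2))).sub (hmul.const_mul (Real.exp (t / 2))))
    convert this using 2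
    simp only [mul_one, mul_zero, sub_zero, ← Real.exp_add]
    rw [neg_div, add_neg_cancel, Real.exp_zero]
  obtain ⟨n, hn, hpos⟩ := ((eventually_ge_atTop n₀).and
    (hlimE.eventually_const_lt one_pos)).exists
  obtain ⟨u, -, hu⟩ := hr1 n hn
  set c := dg (-(s n)) * k n * dg (s n) with hc
  have hγn : T n * γ n * dg (s n) = y * dg u * c := by
    rw [hc, ← hu, ← hk, ← dg_inv]; group
  have hmem := (isFlowInvariant_flowOrbit Γ g).right _ (dg_mem_Nrm (s n)) _
    ((isFlowInvariant_flowOrbit Γ g).left _ (hT n) _ (hγ n))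
  -- The translate of `g` and its image under `B` may not cross, while the formula gives a negative
  -- crossing product.
  have hnn := crossProd_nonneg_of_flowOrbit hnc hmem
    ((isFlowInvariant_flowOrbit Γ g).left _ hBΓ _ hmem)
  have e : (y * dg u * c)⁻¹ * (B * (y * dg u * c)) = c⁻¹ * dg t * c := by
    have h1 : B * (y * dg u * c) = y * dg t * dg u * c := by rw [← hBy]; group
    have h2 : dg t * dg u = dg u * dg t := by rw [← dg_add, ← dg_add, add_comm]
    rw [h1, mul_assoc y (dg t), h2]
    group
  rw [hγn, e, crossProd_inv_mul_dg_mul, c00, c11, c01, c10] at hnn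
  have p0 := mul_pos (mul_pos (mul_pos (hent n 0 0) (mul_pos (hent n 0 1) (hent n 1 0))) one_pos)
    (hent n 1 1)
  have p1 := lt_of_le_of_ne (sq_nonneg (Real.exp (t / 2) - Real.exp (-t / 2))) hne.symm
  have p2 := mul_pos (mul_pos p0 p1) hpos
  simp only [mul_one, mul_assoc] at hnn p2
  linarith

/-- The closure of the orbit of a recurrent unit tangent vector whose geodesic has no transverse
self-intersections in the compact quotient is minimal. -/
theorem mem_of_isForwardRecurrent (hcoc : ∃ K : Set SL(2, ℝ), IsCompact K ∧ ∀ h, ∃ T ∈ Γ, T * h ∈ K)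
    (hfwd : IsForwardRecurrent Γ g) (hbwd : IsForwardRecurrent Γ (g * weyl))
    (hnc : ∀ T ∈ Γ, 0 ≤ crossProd (g⁻¹ * T * g))
    (hN : IsFlowInvariant Γ N) (hcl : IsClosed N) (hne : N.Nonempty)
    (hsub : N ⊆ closure (flowOrbit Γ g)) : g ∈ N := by
  by_contra hg
  obtain ⟨K, hK, hKΓ⟩ := hcoc
  -- Crossings are excluded by continuity, common endpoints by recurrence and `g ∉ N`.
  have hpos : ∀ h ∈ N, ∀ γ ∈ flowOrbit Γ g, 0 < crossProd (h⁻¹ * γ) := fun h hh γ hγ =>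
    lt_of_le_of_ne (crossProd_nonneg_of_closure hnc (hsub hh) (subset_closure hγ))
      fun h0 => hg (mem_of_recurrent_of_crossProd_eq_zero hN hcl hfwd hbwd hh hγ h0.symm)
  have hε : ∀ n : ℕ, (0 : ℝ) < 1 / (n + 2) ∧ (1 : ℝ) / (n + 2) < 1 := fun n => by
    have : (0 : ℝ) ≤ n := n.cast_nonneg
    exact ⟨by positivity, by rw [div_lt_one (by positivity)]; linarith⟩
  choose h₀ hh₀ γ₀ hγ₀ hmin₀ hent₀ hnorm₀ using fun n : ℕ =>
    exists_close_pair hN hcl hne hsub hpos (pow_pos (hε n).1 2)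
  -- Cocompactness moves both ends of every strip into `K`, where a common subsequence converges.
  choose T₀ hT₀ hTK using fun n : ℕ => hKΓ (h₀ n * dg (-Real.log (((h₀ n)⁻¹ * γ₀ n) 1 0)))
  choose S₀ hS₀ hSK using fun n : ℕ => hKΓ (h₀ n * dg (Real.log (((h₀ n)⁻¹ * γ₀ n) 0 1)))
  obtain ⟨⟨x, x'⟩, -, φ, hφ, hlim⟩ := (hK.prod hK).tendsto_subseq
    (x := fun n => (T₀ n * h₀ n * dg (-Real.log (((h₀ n)⁻¹ * γ₀ n) 1 0)),
      S₀ n * h₀ n * dg (Real.log (((h₀ n)⁻¹ * γ₀ n) 0 1))))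
    fun n => by simp only [mul_assoc]; exact ⟨hTK n, hSK n⟩
  have hlim1 := (continuous_fst.tendsto _).comp hlim
  have hlim2 := (continuous_snd.tendsto _).comp hlim
  have hε0 : Tendsto (fun n : ℕ => (1 : ℝ) / (φ n + 2)) atTop (𝓝 0) := by
    refine Tendsto.comp (g := fun n : ℕ => (1 : ℝ) / (n + 2)) ?_ hφ.tendsto_atTop
    exact tendsto_const_nhds.div_atTop
      (tendsto_atTop_add_const_right _ _ tendsto_natCast_atTop_atTop)
  have hclose := fun n => entries_close_to_one (hent₀ (φ n)) (hnorm₀ (φ n)) (hε _).1 (hε _).2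
  refine false_of_close_pairs hnc hN (fun n => hh₀ (φ n)) (fun n => hγ₀ (φ n))
    (fun n => hT₀ (φ n)) (fun n => hS₀ (φ n)) (fun n => hmin₀ (φ n))
    (fun a ha b hb => crossProd_nonneg_of_closure hnc (hsub ha) (hsub hb))
    (fun a ha n => (hpos a ha _ (hγ₀ (φ n))).le)
    (k := fun n => (h₀ (φ n))⁻¹ * γ₀ (φ n)) (s := fun n => -Real.log (((h₀ (φ n))⁻¹ * γ₀ (φ n)) 1 0))
    (s' := fun n => Real.log (((h₀ (φ n))⁻¹ * γ₀ (φ n)) 0 1))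
    (fun _ => rfl) (fun _ => rfl) (fun _ => rfl) (fun n => hent₀ (φ n)) ?_ ?_ ?_ ?_ hlim1 hlim2
  · refine tendsto_iff_of_dist (f₁ := fun _ : ℕ => (1 : ℝ)) ?_ |>.1 tendsto_const_nhds
    refine squeeze_zero (fun n => dist_nonneg) (fun n => ?_) (by simpa only [mul_zero] using hε0.const_mul 2)
    rw [Real.dist_eq, abs_sub_comm]
    exact (hclose n).1.le
  · refine tendsto_iff_of_dist (f₁ := fun _ : ℕ => (1 : ℝ)) ?_ |>.1 tendsto_const_nhds
    refine squeeze_zero (fun n => dist_nonneg) (fun n => ?_) (by simpa only [mul_zero] using hε0.const_mul 2)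
    rw [Real.dist_eq, abs_sub_comm]
    exact (hclose n).2.1.le
  · exact squeeze_zero (fun n => (hent₀ (φ n) 0 1).le) (fun n => (hclose n).2.2.1.le) hε0
  · exact squeeze_zero (fun n => (hent₀ (φ n) 1 0).le) (fun n => (hclose n).2.2.2.le) hε0

end Recurrent

/-! ### The quotient surface -/

section Quotient

variable {Γ : Subgroup SL(2, ℝ)} {g : SL(2, ℝ)}

lemma proj_eq_iff {z w : ℍ} : proj Γ z = proj Γ w ↔ ∃ T ∈ Γ, T • w = z := by
  refine (Quotient.eq (r := MulAction.orbitRel Γ ℍ)).trans ?_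
  rw [MulAction.orbitRel_apply]
  exact ⟨fun ⟨T, hT⟩ => ⟨T, T.2, hT⟩, fun ⟨T, hT, h⟩ => ⟨⟨T, hT⟩, h⟩⟩

lemma proj_smul {T : SL(2, ℝ)} (hT : T ∈ Γ) (z : ℍ) : proj Γ (T • z) = proj Γ z :=
  proj_eq_iff.2 ⟨T, hT, rfl⟩

lemma proj_surjective (Γ : Subgroup SL(2, ℝ)) : Function.Surjective (proj Γ) :=
  Quotient.mk_surjective

lemma proj_out (x : Surface Γ) : proj Γ (Quotient.out x) = x := Quotient.out_eq x

@[fun_prop]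
lemma continuous_proj (Γ : Subgroup SL(2, ℝ)) : Continuous (proj Γ) :=
  continuous_quotient_mk' (s := MulAction.orbitRel Γ ℍ)

lemma isQuotientMap_proj (Γ : Subgroup SL(2, ℝ)) : IsQuotientMap (proj Γ) :=
  isQuotientMap_quot_mk

lemma isOpenMap_proj (Γ : Subgroup SL(2, ℝ)) : IsOpenMap (proj Γ) :=
  isOpenMap_quotient_mk'_mul (Γ := Γ) (T := ℍ)

lemma IsClosedSurfaceGroup.t2Space (hΓ : IsClosedSurfaceGroup Γ) : T2Space (Surface Γ) := by
  have := hΓ.discrete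
  exact t2Space_of_properlyDiscontinuousSMul_of_t2Space (Γ := Γ) (T := ℍ)

/-- The injectivity radius is positive at each point. -/
lemma IsClosedSurfaceGroup.exists_injectivity_radius (hΓ : IsClosedSurfaceGroup Γ) (z : ℍ) :
    ∃ ε > 0, ∀ T ∈ Γ, dist (T • z) z < ε → ∀ w : ℍ, T • w = w := by
  have := hΓ.discrete
  have hfin := finite_disjoint_inter_image (Γ := Γ) (isCompact_closedBall z 1)
    (isCompact_closedBall z 1)
  set A := {T : Γ | ((fun x => T • x) '' Metric.closedBall z 1 ∩ Metric.closedBall z 1).Nonempty}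
  have hev : ∀ᶠ ε : ℝ in 𝓝[>] 0, ∀ T ∈ A, ((T : SL(2, ℝ)) • z ≠ z → ε ≤ dist ((T : SL(2, ℝ)) • z) z) := by
    refine (Filter.eventually_all_finite hfin).2 fun T _ => ?_
    by_cases h : (T : SL(2, ℝ)) • z = z
    · exact Eventually.of_forall fun ε hne => absurd h hne
    · have : ∀ᶠ ε : ℝ in 𝓝[>] 0, ε ≤ dist ((T : SL(2, ℝ)) • z) z :=
        nhdsWithin_le_nhds (eventually_le_nhds (dist_pos.2 h))
      exact this.mono fun ε hε _ => hε
  obtain ⟨ε, ⟨hε, hε1⟩, hε0⟩ := ((hev.and (nhdsWithin_le_nhds (eventually_le_nhds one_pos))).and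
    self_mem_nhdsWithin).exists
  refine ⟨ε, hε0, fun T hT hd => hΓ.free T hT z ?_⟩
  by_contra hne
  refine absurd (hε ⟨T, hT⟩ ?_ hne) (not_le.2 hd)
  refine ⟨T • z, ⟨z, by simp, rfl⟩, ?_⟩
  exact (hd.trans_le hε1).le

/-- A set of representatives of the unit tangent vectors of the compact quotient. -/
lemma IsClosedSurfaceGroup.exists_compact (hΓ : IsClosedSurfaceGroup Γ) :
    ∃ K : Set SL(2, ℝ), IsCompact K ∧ ∀ h, ∃ T ∈ Γ, T * h ∈ K := by
  have := hΓ.cocompact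
  obtain ⟨n, hn⟩ := isCompact_univ.elim_directed_cover
    (fun n : ℕ => proj Γ '' Metric.ball I n) (fun n => isOpenMap_proj Γ _ Metric.isOpen_ball)
    (fun x _ => by
      obtain ⟨z, rfl⟩ := proj_surjective Γ x
      obtain ⟨n, hn⟩ := exists_nat_gt (dist z I)
      exact mem_iUnion.2 ⟨n, z, hn, rfl⟩)
    (Monotone.directed_le fun m n hmn => image_mono (Metric.ball_subset_ball (by exact_mod_cast hmn)))
  refine ⟨_, UpperHalfPlane.isProperMap_smul_I.isCompact_preimage (isCompact_closedBall I (n : ℝ)),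
    fun h => ?_⟩
  obtain ⟨z, hz, hzh⟩ := hn (mem_univ (proj Γ (h • I)))
  obtain ⟨T, hT, rfl⟩ := proj_eq_iff.1 hzh
  refine ⟨T, hT, ?_⟩
  rw [mem_preimage, mul_smul]
  exact Metric.ball_subset_closedBall hz

lemma surfDist_le (z w : ℍ) : surfDist Γ (proj Γ z) (proj Γ w) ≤ dist z w :=
  csInf_le ⟨0, by rintro _ ⟨_, _, -, -, rfl⟩; exact dist_nonneg⟩ ⟨z, w, rfl, rfl, rfl⟩

lemma isGeodesic_proj_geo (hΓ : IsClosedSurfaceGroup Γ) (g : SL(2, ℝ)) :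
    IsGeodesic Γ fun t => proj Γ (geo g t) := by
  intro t
  obtain ⟨ε, hε, hinj⟩ := hΓ.exists_injectivity_radius (geo g t)
  -- A shorter connection between other lifts would give a covering transformation moving `geo g t`
  -- by less than `2 * |s - t| + 2 * |s' - t| < ε`.
  refine ⟨ε / 4, by positivity, fun s hs s' hs' => ?_⟩
  rw [Metric.mem_ball, Real.dist_eq] at hs hs'
  refine le_antisymm ((surfDist_le _ _).trans_eq (dist_geo g s s')) ?_
  refine le_csInf ⟨_, _, _, rfl, rfl, rfl⟩ ?_
  rintro _ ⟨z, w, hz, hw, rfl⟩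
  obtain ⟨T, hT, rfl⟩ := proj_eq_iff.1 hz
  obtain ⟨T', hT', rfl⟩ := proj_eq_iff.1 hw
  rw [← dist_smul T'⁻¹, inv_smul_smul, smul_smul]
  by_contra! hlt
  have htriv := hinj (T'⁻¹ * T) (Γ.mul_mem (Γ.inv_mem hT') hT) (by
    have h1 := dist_triangle4 ((T'⁻¹ * T) • geo g t) ((T'⁻¹ * T) • geo g s) (geo g s') (geo g t)
    rw [dist_smul, dist_geo, dist_geo, abs_sub_comm t s] at h1
    have h2 : |s - s'| ≤ |s - t| + |s' - t| := by
      rw [abs_sub_comm s' t]; exact abs_sub_le _ _ _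
    linarith)
  rw [htriv, dist_geo] at hlt
  exact lt_irrefl _ hlt

/-- A simple geodesic has no transverse crossings with its translates. -/
lemma IsSimpleGeodesic.crossProd_nonneg (hΓ : IsClosedSurfaceGroup Γ)
    (h : IsSimpleGeodesic Γ fun t => proj Γ (geo g t)) {T : SL(2, ℝ)} (hT : T ∈ Γ) :
    0 ≤ crossProd (g⁻¹ * T * g) := by
  by_contra! hneg
  set k := g⁻¹ * T * g with hk
  have hd := det_eq k
  have hP : crossProd k = (k 0 0 * k 1 1) * (k 0 1 * k 1 0) := by unfold crossProd; ring
  have hne : k 0 0 * k 1 0 ≠ 0 := fun h0 => by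
    have : crossProd k = (k 0 0 * k 1 0) * (k 0 1 * k 1 1) := by unfold crossProd; ring
    rw [this, h0, zero_mul] at hneg
    exact lt_irrefl _ hneg
  have hTgeo : ∀ s, T • geo g s = g • ((k * dg s) • I) := fun s => by
    rw [geo, smul_smul, smul_smul, hk]; congr 1; group
  have hre : ∀ s, ((k * dg s) • I).re = 0 ↔
      k 0 0 * k 1 0 * Real.exp s + k 0 1 * k 1 1 * Real.exp (-s) = 0 := fun s => by
    have e1 : Real.exp s = Real.exp (s / 2) * Real.exp (s / 2) := by
      rw [← Real.exp_add, add_halves]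
    have e2 : Real.exp (-s) = Real.exp (-s / 2) * Real.exp (-s / 2) := by
      rw [← Real.exp_add, add_halves]
    rw [smul_I_re, div_eq_zero_iff, or_iff_left (denom_sq_pos _).ne', e1, e2]
    simp only [mul_apply_two, dg_00, dg_01, dg_10, dg_11, mul_zero, zero_add, add_zero]
    constructor <;> intro h <;> linear_combination h
  -- the crossing point
  have hq : 0 < -(k 0 1 * k 1 1) / (k 0 0 * k 1 0) := by
    rw [neg_div, neg_pos]
    have : k 0 1 * k 1 1 / (k 0 0 * k 1 0) = crossProd k / (k 0 0 * k 1 0) ^ 2 := by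
      unfold crossProd; field_simp
    rw [this]
    exact div_neg_of_neg_of_pos hneg (by positivity)
  set t := Real.log (-(k 0 1 * k 1 1) / (k 0 0 * k 1 0)) / 2 with ht
  have hexp : Real.exp t * Real.exp t = -(k 0 1 * k 1 1) / (k 0 0 * k 1 0) := by
    rw [← Real.exp_add, ht, add_halves, Real.exp_log hq]
  have ht0 : ((k * dg t) • I).re = 0 := by
    rw [hre]
    have h1 : k 0 0 * k 1 0 * (Real.exp t * Real.exp t) = -(k 0 1 * k 1 1) := by
      rw [hexp, ← mul_div_assoc, mul_div_cancel_left₀ _ hne]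
    have h2 : Real.exp t * Real.exp (-t) = 1 := by rw [← Real.exp_add]; simp
    linear_combination Real.exp (-t) * h1 - k 0 0 * k 1 0 * Real.exp t * h2
  set s := Real.log ((k * dg t) • I).im with hs
  have hcross : T • geo g t = geo g s := by
    rw [hTgeo, eq_dg_smul_of_re_eq_zero ht0, ← hs, geo, mul_smul]
  -- Simplicity makes the projections agree beyond the crossing point. Below the injectivity radius
  -- the agreement lifts to the plane, giving a second intersection with the vertical geodesic,
  -- whereas the equation in `hre` has only one root.
  have hgeo := h.2 t s (by simp only [← hcross, proj_smul hT])
  obtain ⟨ε, hε, hinj⟩ := hΓ.exists_injectivity_radius (geo g s)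
  obtain ⟨T', hT', hTu⟩ := proj_eq_iff.1 (hgeo (ε / 3)).symm
  have htriv := hinj (T' * T⁻¹) (Γ.mul_mem hT' (Γ.inv_mem hT)) (by
    have h1 := dist_triangle ((T' * T⁻¹) • geo g s) ((T' * T⁻¹) • (T • geo g (t + ε / 3)))
      (geo g s)
    have h2 : dist (geo g s) (T • geo g (t + ε / 3)) = ε / 3 := by
      rw [← hcross, dist_smul, dist_geo, sub_add_cancel_left, abs_neg, abs_of_pos (by positivity)]
    rw [dist_smul, h2, smul_smul, inv_mul_cancel_right, hTu, dist_geo, add_sub_cancel_left,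
      abs_of_pos (by positivity)] at h1
    linarith)
  have hTu' : T • geo g (t + ε / 3) = geo g (s + ε / 3) := by
    rw [← hTu, ← htriv (T • geo g (t + ε / 3)), smul_smul, inv_mul_cancel_right]
  have h2 : ((k * dg (t + ε / 3)) • I).re = 0 := by
    have h3 : (k * dg (t + ε / 3)) • I = dg (s + ε / 3) • I := by
      rw [hTgeo, geo, mul_smul g] at hTu'
      exact smul_left_cancel g hTu'
    rw [h3, re_geo_one]
  rw [hre] at ht0 h2
  have e1 : Real.exp (t + ε / 3) = Real.exp t * Real.exp (ε / 3) := Real.exp_add _ _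
  have e2 : Real.exp (-(t + ε / 3)) * Real.exp (ε / 3) = Real.exp (-t) := by
    rw [← Real.exp_add]; ring_nf
  have h4 : k 0 0 * k 1 0 * Real.exp t * (Real.exp (ε / 3) ^ 2 - 1) = 0 := by
    rw [e1] at h2
    linear_combination Real.exp (ε / 3) * h2 - k 0 1 * k 1 1 * e2 - ht0
  have h5 : 1 < Real.exp (ε / 3) := Real.one_lt_exp_iff.2 (by positivity)
  rcases mul_eq_zero.1 h4 with h6 | h6
  · exact (mul_ne_zero hne (Real.exp_pos t).ne') h6
  · nlinarith

/-- The set of points of the surface on the geodesics of the unit tangent vectors in `L`. -/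
def support (Γ : Subgroup SL(2, ℝ)) (L : Set SL(2, ℝ)) : Set (Surface Γ) :=
  (fun h : SL(2, ℝ) => proj Γ (h • I)) '' L

/-- The preimage in the plane is the set of base points of `L`, closed because passing to base
points is a proper map. -/
lemma isClosed_support {L : Set SL(2, ℝ)} (hL : IsFlowInvariant Γ L) (hcl : IsClosed L) :
    IsClosed (support Γ L) := by
  rw [← (isQuotientMap_proj Γ).isClosed_preimage]
  have : proj Γ ⁻¹' support Γ L = (fun h : SL(2, ℝ) => h • I) '' L := by
    ext z
    constructor
    · rintro ⟨h, hh, e⟩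
      obtain ⟨T, hT, rfl⟩ := proj_eq_iff.1 e.symm
      exact ⟨T * h, hL.left T hT h hh, mul_smul _ _ _⟩
    · rintro ⟨h, hh, rfl⟩
      exact ⟨h, hh, rfl⟩
  rw [this]
  exact UpperHalfPlane.isProperMap_smul_I.isClosedMap _ hcl

lemma range_subset_support {L : Set SL(2, ℝ)} (hL : IsFlowInvariant Γ L) {h : SL(2, ℝ)}
    (hh : h ∈ L) : range (fun t => proj Γ (geo h t)) ⊆ support Γ L := by
  rintro _ ⟨t, rfl⟩
  exact ⟨h * dg t, hL.right _ (dg_mem_Nrm t) h hh, rfl⟩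

lemma support_flowOrbit (h : SL(2, ℝ)) :
    support Γ (flowOrbit Γ h) = range fun t => proj Γ (geo h t) := by
  refine Subset.antisymm ?_ (range_subset_support (isFlowInvariant_flowOrbit Γ h)
    (mem_flowOrbit_self Γ h))
  rintro _ ⟨_, ⟨T, hT, q, hq, rfl⟩, rfl⟩
  have : (h * q) • I ∈ range (geo h) := by
    rw [← range_geo_mul hq]; exact ⟨0, geo_zero _⟩
  obtain ⟨t, ht⟩ := this
  refine ⟨t, ?_⟩
  simp only [ht, mul_assoc, mul_smul T, proj_smul hT]

lemma closure_range_eq_support (h : SL(2, ℝ)) :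
    closure (range fun t => proj Γ (geo h t)) = support Γ (closure (flowOrbit Γ h)) := by
  have hinv := isFlowInvariant_flowOrbit Γ h
  refine Subset.antisymm ?_ ?_
  · refine closure_minimal ?_ (isClosed_support hinv.closure isClosed_closure)
    exact range_subset_support hinv.closure (subset_closure (mem_flowOrbit_self Γ h))
  · rw [← support_flowOrbit]
    exact image_closure_subset_closure_image (by fun_prop)

/-- If two non-crossing geodesics pass through the same point, they agree up to orientation. -/
lemma mem_Nrm_of_smul_I {k : SL(2, ℝ)} (hk : k • I = I) (hP : 0 ≤ crossProd k) : k ∈ Nrm := by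
  have h1 := two_cosh_dist_smul_I k
  rw [hk, dist_self, Real.cosh_zero] at h1
  have hd := det_eq k
  unfold normSq at h1
  have h2 : (k 0 0 - k 1 1) ^ 2 + (k 0 1 + k 1 0) ^ 2 = 0 := by nlinarith
  have h3 : k 0 0 = k 1 1 := by nlinarith [sq_nonneg (k 0 0 - k 1 1), sq_nonneg (k 0 1 + k 1 0)]
  have h4 : k 0 1 = - k 1 0 := by
    nlinarith [sq_nonneg (k 0 0 - k 1 1), sq_nonneg (k 0 1 + k 1 0)]
  unfold crossProd at hP
  rw [h3, h4] at hP
  have h5 : (k 1 1 * k 1 0) ^ 2 = 0 := by nlinarith [sq_nonneg (k 1 1 * k 1 0)]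
  rcases mul_eq_zero.1 (pow_eq_zero_iff two_ne_zero |>.1 h5) with h6 | h6
  · exact Or.inr ⟨h3.trans h6, h6⟩
  · exact Or.inl ⟨by rw [h4, h6, neg_zero], h6⟩

/-- A closed invariant set of unit tangent vectors without crossings is a geodesic lamination. -/
lemma exists_isGeodesicLamination (hΓ : IsClosedSurfaceGroup Γ) {L : Set SL(2, ℝ)}
    (hL : IsFlowInvariant Γ L) (hcl : IsClosed L)
    (hnc : ∀ a ∈ L, ∀ b ∈ L, 0 ≤ crossProd (a⁻¹ * b)) :
    ∃ β : Surface Γ → ℝ → Surface Γ, IsGeodesicLamination Γ (support Γ L) β ∧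
      ∀ x ∈ support Γ L, ∃ h ∈ L, β x = fun t => proj Γ (geo h t) := by
  classical
  have hch : ∀ x : Surface Γ, ∃ h : SL(2, ℝ), x ∈ support Γ L → h ∈ L ∧ proj Γ (h • I) = x := by
    intro x
    by_cases hx : x ∈ support Γ L
    · obtain ⟨h, hh, e⟩ := hx
      exact ⟨h, fun _ => ⟨hh, e⟩⟩
    · exact ⟨1, fun h => absurd h hx⟩
  choose v hv using hch
  have hsame : ∀ a ∈ L, ∀ b ∈ L, proj Γ (a • I) = proj Γ (b • I) →
      ∃ T ∈ Γ, ∃ q ∈ Nrm, q • I = I ∧ a = T * b * q := by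
    intro a ha b hb hab
    obtain ⟨T, hT, e⟩ := proj_eq_iff.1 hab
    have hI : ((T * b)⁻¹ * a) • I = I := by
      rw [mul_smul, ← e, ← mul_smul T, inv_smul_smul]
    exact ⟨T, hT, (T * b)⁻¹ * a, mem_Nrm_of_smul_I hI (hnc _ (hL.left T hT b hb) _ ha), hI,
      by group⟩
  have hrange : ∀ {T : SL(2, ℝ)} (_ : T ∈ Γ) {q} (_ : q ∈ Nrm) (b : SL(2, ℝ)),
      range (fun t => proj Γ (geo (T * b * q) t)) = range fun t => proj Γ (geo b t) := by
    intro T hT q hq b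
    have h1 : ∀ a : SL(2, ℝ), range (fun t => proj Γ (geo a t)) = proj Γ '' range (geo a) :=
      fun a => range_comp (proj Γ) (geo a)
    rw [h1, range_geo_mul hq, ← h1]
    congr 1
    funext t
    rw [geo_mul, proj_smul hT]
  refine ⟨fun x t => proj Γ (geo (v x) t), ⟨isClosed_support hL hcl, ?_, ?_, ?_, ?_⟩,
    fun x hx => ⟨v x, (hv x hx).1, rfl⟩⟩
  · refine Subset.antisymm (fun x hx => ?_) (iUnion₂_subset fun x hx =>
      range_subset_support hL (hv x hx).1)
    refine mem_iUnion₂.2 ⟨x, hx, 0, ?_⟩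
    simp only [geo_zero, (hv x hx).2]
  · refine fun x hx => ⟨isGeodesic_proj_geo hΓ _, fun s t hst u => ?_⟩
    obtain ⟨T, hT, q, hq, hqI, e⟩ := hsame _ (hL.right _ (dg_mem_Nrm s) _ (hv x hx).1) _
      (hL.right _ (dg_mem_Nrm t) _ (hv x hx).1) hst
    have hdir : ∀ q', (∀ u, geo q' u = dg u • I) → q = q' →
        proj Γ (geo (v x) (s + u)) = proj Γ (geo (v x) (t + u)) := by
      rintro q' hq' rfl
      rw [← geo_mul_dg, ← geo_mul_dg, e, geo_mul (T * _), hq', mul_smul T,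
        proj_smul hT, geo, mul_smul (v x * dg t)]
    obtain ⟨r, hr⟩ := Nrm_cases hq
    -- As `q` fixes `I`, only the four elements `±1` and `±weyl` remain: same direction or reversal.
    have hr0 : r = 0 := by
      have h1 : dg r • I = I := by
        rcases hr with h | h | h | h <;> rw [h] at hqI <;>
          simpa [neg_smul_pt, mul_smul, weyl_smul_I] using hqI
      have h2 := congrArg UpperHalfPlane.im h1
      rw [im_geo_one] at h2
      simpa using h2
    rw [hr0, dg_zero, one_mul] at hr
    have hrot : ∀ q' : SL(2, ℝ), (∀ u, geo q' u = geo weyl u) → q ≠ q' := by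
      rintro q' hq' rfl
      -- a covering transformation reversing the geodesic has a fixed point
      have hrev : ∀ a, T • geo (v x) (t + a) = geo (v x) (s - a) := by
        intro a
        have h1 : geo (v x) (s - a) = geo (v x * dg s) (-a) := by rw [geo_mul_dg, sub_eq_add_neg]
        have h2 : geo q (-a) = dg a • I := by
          rw [hq', show weyl = 1 * weyl by simp, geo_mul_weyl, neg_neg, geo, one_mul]
        rw [h1, e, geo_mul (T * _), h2, ← geo_mul_dg, geo, mul_smul, ← mul_smul T]
      have hfix := hΓ.free T hT (geo (v x) ((s + t) / 2)) (by
        have := hrev ((s - t) / 2)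
        convert this using 2 <;> ring_nf)
      have h1 := hrev ((s - t) / 2 + 1)
      rw [hfix] at h1
      have h2 := (isometry_geo (v x)).injective h1
      linarith
    rcases hr with h | h | h | h
    · exact hdir 1 (fun u => by rw [geo, one_mul]) h
    · exact hdir (-1) (fun u => by rw [geo_neg, geo, one_mul]) h
    · exact absurd h (hrot _ fun u => rfl)
    · exact absurd h (hrot _ fun u => geo_neg _ _)
  · intro x hx
    simp only [geo_zero, (hv x hx).2]
  · intro x hx y hy
    by_cases hdisj : Disjoint (range fun t => proj Γ (geo (v x) t))
      (range fun t => proj Γ (geo (v y) t))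
    · exact Or.inl hdisj
    · right
      obtain ⟨_, ⟨s, rfl⟩, ⟨t, ht⟩⟩ := not_disjoint_iff.1 hdisj
      obtain ⟨T, hT, q, hq, -, e⟩ := hsame _ (hL.right _ (dg_mem_Nrm t) _ (hv y hy).1) _
        (hL.right _ (dg_mem_Nrm s) _ (hv x hx).1) ht
      have h1 := hrange hT hq (v x * dg s)
      rw [← e] at h1
      have h2 := hrange Γ.one_mem (dg_mem_Nrm s) (v x)
      have h3 := hrange Γ.one_mem (dg_mem_Nrm t) (v y)
      rw [one_mul] at h2 h3
      exact h2.symm.trans (h1.symm.trans h3)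

end Quotient

/-! ### Sublinear tracking in the hyperbolic plane -/

lemma tendsto_div_nat_zero_iff {a : ℕ → ℝ} (ha : ∀ n, 0 ≤ a n) :
    Tendsto (fun n => a n / n) atTop (𝓝 0) ↔ ∀ ε > 0, ∀ᶠ n : ℕ in atTop, a n ≤ ε * n := by
  constructor
  · intro h ε hε
    filter_upwards [h.eventually_lt_const hε, eventually_gt_atTop 0] with n hn hn0
    rw [div_lt_iff₀ (by exact_mod_cast hn0)] at hn
    exact hn.le
  · intro h
    rw [Metric.tendsto_atTop']
    intro ε hε
    obtain ⟨N, hN⟩ := eventually_atTop.1 (h (ε / 2) (by positivity))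
    refine ⟨N, fun n hn => ?_⟩
    have hn0 : (0 : ℝ) < n := by exact_mod_cast (Nat.zero_le N).trans_lt hn
    rw [Real.dist_eq, sub_zero, abs_of_nonneg (div_nonneg (ha n) hn0.le), div_lt_iff₀ hn0]
    have := hN n hn.le
    nlinarith

lemma eventually_abs_sub_le {r : ℕ → ℝ} {θ : ℝ} (h : Tendsto (fun n => r n / n) atTop (𝓝 θ))
    {ε : ℝ} (hε : 0 < ε) : ∀ᶠ n : ℕ in atTop, |r n - n * θ| ≤ ε * n := by
  filter_upwards [(Metric.tendsto_nhds.1 h) ε hε, eventually_gt_atTop 0] with n hn hn0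
  have hn0' : (0 : ℝ) < n := by exact_mod_cast hn0
  rw [Real.dist_eq] at hn
  have : r n - n * θ = (r n / n - θ) * n := by field_simp
  rw [this, abs_mul, abs_of_pos hn0']
  exact mul_le_mul_of_nonneg_right hn.le hn0'.le

/-- The hyperbolic law of cosines in half-angle form: `p * p' + q * q'` and `p * q' - q * p'` are
the cosine and sine of half the angle between the rays. -/
lemma two_cosh_dist_polar {p q p' q' : ℝ} (h : p ^ 2 + q ^ 2 = 1) (h' : p' ^ 2 + q' ^ 2 = 1)
    (r r' : ℝ) : Real.cosh (dist (geo (rot p q h) r) (geo (rot p' q' h') r')) =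
      (p * p' + q * q') ^ 2 * Real.cosh (r - r') + (p * q' - q * p') ^ 2 * Real.cosh (r + r') := by
  have h1 := two_cosh_dist_smul_smul (rot p q h * dg r) (rot p' q' h' * dg r')
  rw [← geo_def, ← geo_def] at h1
  have e : ∀ t, Real.exp t = Real.exp (t / 2) ^ 2 := fun t => by
    rw [← Real.exp_nat_mul]; ring_nf
  have e1 : Real.exp (r - r') = (Real.exp (r / 2) * Real.exp (-r' / 2)) ^ 2 := by
    rw [← Real.exp_add, ← Real.exp_nat_mul]; ring_nf
  have e2 : Real.exp (-(r - r')) = (Real.exp (-r / 2) * Real.exp (r' / 2)) ^ 2 := by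
    rw [← Real.exp_add, ← Real.exp_nat_mul]; ring_nf
  have e3 : Real.exp (r + r') = (Real.exp (r / 2) * Real.exp (r' / 2)) ^ 2 := by
    rw [← Real.exp_add, ← Real.exp_nat_mul]; ring_nf
  have e4 : Real.exp (-(r + r')) = (Real.exp (-r / 2) * Real.exp (-r' / 2)) ^ 2 := by
    rw [← Real.exp_add, ← Real.exp_nat_mul]; ring_nf
  rw [Real.cosh_eq (r - r'), Real.cosh_eq (r + r'), e1, e2, e3, e4]
  simp only [normSq, mul_apply_two, inv_apply_00, inv_apply_01, inv_apply_10, inv_apply_11,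
    rot_00, rot_01, rot_10, rot_11, dg_00, dg_01, dg_10, dg_11] at h1
  linear_combination h1 / 2

lemma exp_le_two_cosh (t : ℝ) : Real.exp t ≤ 2 * Real.cosh t := by
  rw [Real.cosh_eq]; linarith [Real.exp_pos (-t)]

lemma cosh_le_exp_of_abs_le {t s : ℝ} (h : |t| ≤ s) : Real.cosh t ≤ Real.exp s := by
  have h1 := Real.exp_le_exp.2 ((le_abs_self t).trans h)
  have h2 := Real.exp_le_exp.2 ((neg_le_abs t).trans h)
  rw [Real.cosh_eq]; linarith

/-- The direction of `rot p q` as a complex number of modulus one. -/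
def direction (p q : ℝ) : ℂ := ⟨p ^ 2 - q ^ 2, 2 * p * q⟩

lemma dist_direction_sq {p q p' q' : ℝ} (h : p ^ 2 + q ^ 2 = 1) (h' : p' ^ 2 + q' ^ 2 = 1) :
    dist (direction p q) (direction p' q') ^ 2 = 4 * (p * q' - q * p') ^ 2 := by
  rw [Complex.dist_eq, ← Complex.normSq_eq_norm_sq, Complex.normSq_apply]
  simp only [direction, Complex.sub_re, Complex.sub_im]
  linear_combination ((p ^ 2 + q ^ 2) - 2 * (p' ^ 2 + q' ^ 2) + 1) * h + (1 + (p' ^ 2 + q' ^ 2) - 2) * h'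

/-- A sequence of points of the hyperbolic plane with bounded steps and positive linear speed
tracks a geodesic ray up to a sublinear error. -/
lemma exists_ray_tracking {x : ℕ → ℍ} {C θ : ℝ} (hC : ∀ n, dist (x n) (x (n + 1)) ≤ C)
    (hθ : 0 < θ) (hx : Tendsto (fun n => dist (x n) I / n) atTop (𝓝 θ)) :
    ∃ (p q : ℝ) (h : p ^ 2 + q ^ 2 = 1), ∀ ε > 0, ∀ᶠ n : ℕ in atTop,
      dist (x n) (geo (rot p q h) (n * θ)) ≤ ε * n := by
  choose P Q hPQ hpolar using fun n => exists_polar (x n)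
  set r : ℕ → ℝ := fun n => dist (x n) I with hr
  have hC0 : 0 ≤ C := dist_nonneg.trans (hC 0)
  set u : ℕ → ℂ := fun n => direction (P n) (Q n) with hu
  -- A step of length at most `C` bounds the squared half-angle sine by `2 * cosh C * exp (-2ρn)`;
  -- the squared chord is four times that sine squared.
  set M := Real.sqrt (8 * Real.cosh C) with hM
  -- the increments of the directions decay exponentially
  have hstep : ∀ ρ, 0 < ρ → ρ < θ → ∃ N, ∀ n ≥ N, dist (u n) (u (n + 1)) ≤ M * Real.exp (-(ρ * n)) := by
    intro ρ hρ hρθ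
    obtain ⟨N, hN⟩ := eventually_atTop.1 (eventually_abs_sub_le hx (sub_pos.2 hρθ))
    refine ⟨N, fun n hn => ?_⟩
    have hlow : ∀ m ≥ N, ρ * m ≤ r m := fun m hm => by
      have := (abs_le.1 (hN m hm)).1
      simp only [hr]
      nlinarith
    have h1 := hlow n hn
    have h2 := hlow (n + 1) (by omega)
    push_cast at h2
    have h3 : Real.exp (ρ * n) ^ 2 ≤ 2 * Real.cosh (r n + r (n + 1)) := by
      refine le_trans ?_ (exp_le_two_cosh _)
      rw [← Real.exp_nat_mul]
      apply Real.exp_le_exp.2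
      push_cast
      nlinarith
    have h4 : (P n * Q (n + 1) - Q n * P (n + 1)) ^ 2 * Real.cosh (r n + r (n + 1)) ≤
        Real.cosh C := by
      have h5 := two_cosh_dist_polar (hPQ n) (hPQ (n + 1)) (r n) (r (n + 1))
      rw [← hpolar, ← hpolar] at h5
      have h6 : Real.cosh (dist (x n) (x (n + 1))) ≤ Real.cosh C := by
        rw [Real.cosh_le_cosh, abs_of_nonneg dist_nonneg, abs_of_nonneg hC0]
        exact hC n
      have h7 : 0 ≤ (P n * P (n + 1) + Q n * Q (n + 1)) ^ 2 * Real.cosh (r n - r (n + 1)) :=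
        mul_nonneg (sq_nonneg _) (Real.cosh_pos _).le
      linarith
    have hE := Real.exp_pos (ρ * n)
    refine abs_le_of_sq_le_sq' ?_ (by positivity) |>.2
    rw [hu, dist_direction_sq (hPQ _) (hPQ _), mul_pow, hM,
      Real.sq_sqrt (by have := Real.cosh_pos C; positivity), Real.exp_neg, inv_pow,
      ← div_eq_mul_inv, le_div_iff₀ (by positivity)]
    have h8 := mul_le_mul_of_nonneg_left h3 (sq_nonneg (P n * Q (n + 1) - Q n * P (n + 1)))
    linarith
  have hgeom : ∀ ρ : ℝ, 0 < ρ → Real.exp (-ρ) < 1 := fun ρ hρ => by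
    rw [Real.exp_lt_one_iff]; linarith
  have hstep' : ∀ ρ, 0 < ρ → ρ < θ → ∃ N, ∀ n,
      dist (u (n + N)) (u (n + 1 + N)) ≤ M * Real.exp (-(ρ * N)) * Real.exp (-ρ) ^ n := by
    intro ρ hρ hρθ
    obtain ⟨N, hN⟩ := hstep ρ hρ hρθ
    refine ⟨N, fun n => ?_⟩
    have := hN (n + N) (by omega)
    rw [show n + 1 + N = n + N + 1 by ring, mul_assoc, ← Real.exp_nat_mul, ← Real.exp_add]
    convert this using 3
    push_cast
    ring
  -- the limit direction
  obtain ⟨v, hv⟩ : ∃ v, Tendsto u atTop (𝓝 v) := by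
    obtain ⟨N, hN⟩ := hstep' (θ / 2) (by linarith) (by linarith)
    obtain ⟨v, hv⟩ := cauchySeq_tendsto_of_complete
      (cauchySeq_of_le_geometric _ _ (hgeom (θ / 2) (by linarith)) hN)
    exact ⟨v, (tendsto_add_atTop_iff_nat N).1 hv⟩
  have hvn : ‖v‖ ^ 2 = 1 := by
    have h1 : Tendsto (fun n => ‖u n‖ ^ 2) atTop (𝓝 (‖v‖ ^ 2)) := (hv.norm).pow 2
    have h2 : ∀ n, ‖u n‖ ^ 2 = 1 := fun n => by
      rw [← Complex.normSq_eq_norm_sq, Complex.normSq_apply]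
      simp only [hu, direction]
      linear_combination ((P n) ^ 2 + (Q n) ^ 2 + 1) * hPQ n
    simp only [h2] at h1
    exact tendsto_nhds_unique h1 tendsto_const_nhds
  rw [← Complex.normSq_eq_norm_sq, Complex.normSq_apply] at hvn
  obtain ⟨p, q, hpq, hre, him⟩ := exists_half_angle (x := v.re) (y := v.im) (by linarith)
  have hvd : v = direction p q := Complex.ext hre.symm him.symm
  refine ⟨p, q, hpq, fun ε₀ hε₀ => ?_⟩
  -- reduce to small `ε`
  obtain ⟨ε, hε, hεε, hεθ⟩ : ∃ ε, 0 < ε ∧ 4 * ε ≤ ε₀ ∧ ε < θ := by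
    refine ⟨min (ε₀ / 4) (θ / 2), by positivity, ?_, ?_⟩
    · linarith [min_le_left (ε₀ / 4) (θ / 2)]
    · linarith [min_le_right (ε₀ / 4) (θ / 2)]
  -- A rate this close to `θ` is needed: the squared angular error `exp (-2(θ - ε)n)` against `exp
  -- (2θn + εn)` leaves `exp (3εn)`. A further `exp (εn)` absorbs the constants, whence `4 * ε ≤
  -- ε₀`.
  obtain ⟨N, hN⟩ := hstep' (θ - ε) (by linarith) (by linarith)
  have hconv := fun n => dist_le_of_le_geometric_of_tendsto _ _ (hgeom (θ - ε) (by linarith)) hN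
    ((tendsto_add_atTop_iff_nat N).2 hv) n
  set M' := M / (1 - Real.exp (-(θ - ε))) with hM'
  have hconv' : ∀ n ≥ N, dist (u n) v ≤ M' * Real.exp (-((θ - ε) * n)) := by
    intro n hn
    obtain ⟨m, rfl⟩ := Nat.exists_eq_add_of_le' hn
    refine (hconv m).trans_eq ?_
    rw [hM', mul_assoc, ← Real.exp_nat_mul, ← Real.exp_add, div_mul_eq_mul_div]
    congr 3
    push_cast
    ring
  set A := 1 + M' ^ 2 with hA
  have hAexp : ∀ᶠ n : ℕ in atTop, 2 * A ≤ Real.exp (ε * n) := by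
    have : Tendsto (fun n : ℕ => Real.exp (ε * n)) atTop atTop :=
      Real.tendsto_exp_atTop.comp (tendsto_natCast_atTop_atTop.const_mul_atTop hε)
    exact this.eventually_ge_atTop _
  filter_upwards [eventually_ge_atTop N, hAexp, eventually_abs_sub_le hx hε] with n hn hAn hrn
  have hn0 : (0 : ℝ) ≤ n := n.cast_nonneg
  have h1 := two_cosh_dist_polar (hPQ n) hpq (r n) (n * θ)
  rw [← hpolar] at h1
  have h2 := dist_direction_sq (hPQ n) hpq
  rw [← hvd] at h2
  set s := P n * q - Q n * p
  set c := P n * p + Q n * q with hc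
  have h3 : c ^ 2 ≤ 1 := by
    have : c ^ 2 + s ^ 2 = 1 := by
      simp only [c, s]
      linear_combination (p ^ 2 + q ^ 2) * hPQ n + hpq
    nlinarith [sq_nonneg s]
  have h4 : s ^ 2 ≤ M' ^ 2 * Real.exp (-((θ - ε) * n)) ^ 2 := by
    have h5 := hconv' n hn
    have h6 := pow_le_pow_left₀ dist_nonneg h5 2
    rw [mul_pow] at h6
    simp only [hu] at h6
    rw [h2] at h6
    nlinarith [sq_nonneg s]
  have h5 : Real.cosh (r n - n * θ) ≤ Real.exp (3 * ε * n) :=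
    cosh_le_exp_of_abs_le (hrn.trans (by nlinarith))
  have h6 : Real.cosh (r n + n * θ) ≤ Real.exp (2 * θ * n + ε * n) := by
    apply cosh_le_exp_of_abs_le
    rw [abs_of_nonneg (add_nonneg dist_nonneg (by positivity))]
    have := (abs_le.1 hrn).2
    linarith
  have h7 : Real.cosh (dist (x n) (geo (rot p q hpq) (n * θ))) ≤ A * Real.exp (3 * ε * n) := by
    rw [h1]
    have h8 : c ^ 2 * Real.cosh (r n - n * θ) ≤ 1 * Real.exp (3 * ε * n) :=
      mul_le_mul h3 h5 (Real.cosh_pos _).le zero_le_one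
    have h9 : s ^ 2 * Real.cosh (r n + n * θ) ≤ (M' ^ 2 * Real.exp (-((θ - ε) * n)) ^ 2) *
        Real.exp (2 * θ * n + ε * n) :=
      mul_le_mul h4 h6 (Real.cosh_pos _).le (by positivity)
    have h10 : Real.exp (-((θ - ε) * n)) ^ 2 * Real.exp (2 * θ * n + ε * n) =
        Real.exp (3 * ε * n) := by
      rw [← Real.exp_nat_mul, ← Real.exp_add]
      congr 1
      push_cast
      ring
    rw [mul_assoc, h10] at h9
    rw [hA]
    linarith
  have h8 : Real.exp (dist (x n) (geo (rot p q hpq) (n * θ))) ≤ Real.exp (4 * ε * n) := by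
    refine (exp_le_two_cosh _).trans ?_
    have : Real.exp (4 * ε * n) = Real.exp (ε * n) * Real.exp (3 * ε * n) := by
      rw [← Real.exp_add]; ring_nf
    rw [this]
    have := mul_le_mul_of_nonneg_right hAn (Real.exp_pos (3 * ε * n)).le
    linarith
  exact (Real.exp_le_exp.1 h8).trans (mul_le_mul_of_nonneg_right hεε hn0)

lemma two_cosh_dist_geo (g h : SL(2, ℝ)) (t : ℝ) : 2 * Real.cosh (dist (geo g t) (geo h t)) =
    (h⁻¹ * g) 0 0 ^ 2 + (h⁻¹ * g) 0 1 ^ 2 * Real.exp (-(2 * t)) +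
      (h⁻¹ * g) 1 0 ^ 2 * Real.exp (2 * t) + (h⁻¹ * g) 1 1 ^ 2 := by
  have e : (h * dg t)⁻¹ * (g * dg t) = dg (-t) * (h⁻¹ * g) * dg t := by rw [← dg_inv]; group
  rw [geo, geo, two_cosh_dist_smul_smul, e, normSq, conj_dg_00, conj_dg_01, conj_dg_10, conj_dg_11,
    mul_pow, mul_pow, ← Real.exp_nat_mul, ← Real.exp_nat_mul]
  push_cast
  ring_nf

/-- Two geodesics with the same endpoint at infinity stay at bounded distance. -/
lemma exists_dist_geo_le {g h : SL(2, ℝ)} (hk : (h⁻¹ * g) 1 0 = 0) :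
    ∃ B, ∀ t ≥ 0, dist (geo g t) (geo h t) ≤ B := by
  set k := h⁻¹ * g with hkdef
  refine ⟨Real.log (k 0 0 ^ 2 + k 0 1 ^ 2 + k 1 1 ^ 2), fun t ht => ?_⟩
  have h1 := two_cosh_dist_geo g h t
  rw [← hkdef, hk] at h1
  have h2 : Real.exp (-(2 * t)) ≤ 1 := Real.exp_le_one_iff.2 (by linarith)
  have h3 := mul_le_mul_of_nonneg_left h2 (sq_nonneg (k 0 1))
  have h4 := exp_le_two_cosh (dist (geo g t) (geo h t))
  have h5 := Real.exp_pos (dist (geo g t) (geo h t))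
  rw [Real.le_log_iff_exp_le (by linarith)]
  linarith

/-- Two geodesics which are sublinearly close have the same endpoint at infinity. -/
lemma entry_eq_zero_of_dist_geo_le {g h : SL(2, ℝ)} {θ : ℝ} (hθ : 0 < θ)
    (hd : ∀ᶠ n : ℕ in atTop, dist (geo g (n * θ)) (geo h (n * θ)) ≤ θ * n) :
    (h⁻¹ * g) 1 0 = 0 := by
  by_contra hne
  have hlim : Tendsto (fun n : ℕ => 2 * Real.exp (-(θ * n))) atTop (𝓝 0) := by
    have := (Real.tendsto_exp_neg_atTop_nhds_zero.comp
      (tendsto_natCast_atTop_atTop.const_mul_atTop hθ)).const_mul 2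
    simpa using this
  have hpos : 0 < (h⁻¹ * g) 1 0 ^ 2 := by positivity
  obtain ⟨n, hn, hn'⟩ := (hd.and (hlim.eventually_lt_const hpos)).exists
  have h1 := two_cosh_dist_geo g h (n * θ)
  have h2 := cosh_le_exp_of_abs_le (s := θ * n)
    (by rwa [abs_of_nonneg (dist_nonneg (x := geo g (n * θ)))])
  have h3 : (h⁻¹ * g) 1 0 ^ 2 * Real.exp (2 * (n * θ)) ≤ 2 * Real.exp (θ * n) := by
    have t1 := sq_nonneg ((h⁻¹ * g) 0 0)
    have t2 := sq_nonneg ((h⁻¹ * g) 1 1)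
    have t3 := mul_nonneg (sq_nonneg ((h⁻¹ * g) 0 1)) (Real.exp_pos (-(2 * (n * θ)))).le
    linarith
  have h4 : Real.exp (2 * (n * θ)) * Real.exp (-(θ * n)) = Real.exp (θ * n) := by
    rw [← Real.exp_add]; ring_nf
  have h5 : Real.exp (θ * n) * Real.exp (-(θ * n)) = 1 := by
    rw [← Real.exp_add]; simp
  have h6 := mul_le_mul_of_nonneg_right h3 (Real.exp_pos (-(θ * n))).le
  have h7 := mul_lt_mul_of_pos_right hn' (Real.exp_pos (θ * n))
  have h8 : (h⁻¹ * g) 1 0 ^ 2 * Real.exp (θ * n) ≤ 2 := by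
    calc _ = (h⁻¹ * g) 1 0 ^ 2 * Real.exp (2 * (n * θ)) * Real.exp (-(θ * n)) := by
            rw [mul_assoc, h4]
      _ ≤ _ := h6
      _ = 2 := by rw [mul_assoc, h5, mul_one]
  have h9 : 2 * Real.exp (-(θ * n)) * Real.exp (θ * n) = 2 := by
    rw [mul_assoc, mul_comm (Real.exp (-(θ * n))), h5, mul_one]
  linarith

section Tracking

variable {F : ℍ ≃ₜ ℍ} {θ : ℝ} {z : ℍ} {g h : SL(2, ℝ)}

lemma tracks_iff {c : ℝ → ℍ} : Tracks F θ z c ↔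
    (∀ ε > 0, ∀ᶠ n : ℕ in atTop, dist (F^[n] z) (c (n * θ)) ≤ ε * n) ∧
    (∀ ε > 0, ∀ᶠ n : ℕ in atTop, dist (F.symm^[n] z) (c (-(n * θ))) ≤ ε * n) := by
  rw [Tracks, tendsto_div_nat_zero_iff fun _ => dist_nonneg,
    tendsto_div_nat_zero_iff fun _ => dist_nonneg]

lemma eventually_const_le_mul (B : ℝ) {ε : ℝ} (hε : 0 < ε) : ∀ᶠ n : ℕ in atTop, B ≤ ε * n :=
  (tendsto_natCast_atTop_atTop.const_mul_atTop hε).eventually_ge_atTop B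

/-- A geodesic at bounded distance from a tracking geodesic is a tracking geodesic. -/
lemma Tracks.of_dist_le {c c' : ℝ → ℍ} (h : Tracks F θ z c) {B : ℝ} (hB : ∀ t, dist (c t) (c' t) ≤ B) :
    Tracks F θ z c' := by
  rw [tracks_iff] at h ⊢
  constructor <;> intro ε hε
  · filter_upwards [h.1 (ε / 2) (by positivity), eventually_const_le_mul B (half_pos hε)] with n h1 h2
    linarith [dist_triangle (F^[n] z) (c (n * θ)) (c' (n * θ)), hB (n * θ)]
  · filter_upwards [h.2 (ε / 2) (by positivity), eventually_const_le_mul B (half_pos hε)] with n h1 h2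
    linarith [dist_triangle (F.symm^[n] z) (c (-(n * θ))) (c' (-(n * θ))), hB (-(n * θ))]

lemma Tracks.mul_dg (h : Tracks F θ z (geo g)) (s : ℝ) : Tracks F θ z (geo (g * dg s)) :=
  h.of_dist_le (B := |s|) fun t => by rw [geo_mul_dg, dist_geo, sub_add_cancel_right, abs_neg]

lemma iterate_smul {F : ℍ → ℍ} {T : SL(2, ℝ)} (hF : ∀ z, F (T • z) = T • F z) (n : ℕ) (z : ℍ) :
    F^[n] (T • z) = T • F^[n] z :=
  Function.Semiconj.iterate_right (f := (T • ·)) (ga := F) (gb := F) (fun z => (hF z).symm) n z |>.symm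

lemma symm_smul {T : SL(2, ℝ)} (hF : ∀ z, F (T • z) = T • F z) (z : ℍ) :
    F.symm (T • z) = T • F.symm z := by
  rw [Homeomorph.symm_apply_eq, hF, F.apply_symm_apply]

lemma Tracks.smul (h : Tracks F θ z (geo g)) {T : SL(2, ℝ)} (hF : ∀ z, F (T • z) = T • F z) :
    Tracks F θ (T • z) (geo (T * g)) := by
  unfold Tracks at h ⊢
  simpa only [iterate_smul hF, iterate_smul (symm_smul hF), geo_mul, dist_smul] using h

lemma Tracks.symm (h : Tracks F θ z (geo g)) : Tracks F.symm θ z (geo (g * weyl)) := by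
  refine ⟨?_, ?_⟩
  · simpa only [geo_mul_weyl] using h.2
  · simpa only [geo_mul_weyl, neg_neg, F.symm_symm] using h.1

/-- The tracking geodesic of a point is unique up to its parametrization. -/
lemma Tracks.unique (hθ : 0 < θ) (hg : Tracks F θ z (geo g)) (hh : Tracks F θ z (geo h)) :
    ∃ s, ∃ e : SL(2, ℝ), (e = 1 ∨ e = -1) ∧ h = g * dg s * e := by
  have key : ∀ {F : ℍ ≃ₜ ℍ} {g h : SL(2, ℝ)}, Tracks F θ z (geo g) → Tracks F θ z (geo h) →
      (g⁻¹ * h) 1 0 = 0 := by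
    intro F g h hg hh
    rw [tracks_iff] at hg hh
    refine entry_eq_zero_of_dist_geo_le hθ ?_
    filter_upwards [hg.1 (θ / 2) (by positivity), hh.1 (θ / 2) (by positivity)] with n h1 h2
    linarith [dist_triangle_left (geo h (n * θ)) (geo g (n * θ)) (F^[n] z)]
  -- Forward orbits identify the forward endpoints, the inverse map identifies the backward ones;
  -- hence `g⁻¹ * h` is diagonal.
  have h1 := key hg hh
  have h2 := key hg.symm hh.symm
  have e : (g * weyl)⁻¹ * (h * weyl) = weyl⁻¹ * (g⁻¹ * h) * weyl := by group
  rw [e] at h2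
  have h3 : (g⁻¹ * h) 0 1 = 0 := by
    rw [mul_apply_two, mul_apply_two, mul_apply_two weyl⁻¹ _ 1 1] at h2
    simpa only [inv_apply_10, inv_apply_11, weyl_00, weyl_10, weyl_11, neg_mul, zero_mul, add_zero,
      mul_zero, one_mul, mul_one, zero_add, neg_eq_zero] using h2
  rcases lt_or_gt_of_ne (show (g⁻¹ * h) 0 0 ≠ 0 from fun h0 => by
    have := det_eq (g⁻¹ * h); rw [h0, h3] at this; simp at this) with hneg | hpos
  · refine ⟨2 * Real.log ((-(g⁻¹ * h)) 0 0), -1, Or.inr rfl, ?_⟩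
    have := eq_dg (k := -(g⁻¹ * h)) (by rw [neg_apply_two, h3, neg_zero])
      (by rw [neg_apply_two, h1, neg_zero]) (by rw [neg_apply_two]; linarith)
    rw [mul_assoc, ← this, mul_neg_one, neg_neg, mul_inv_cancel_left]
  · refine ⟨2 * Real.log ((g⁻¹ * h) 0 0), 1, Or.inl rfl, ?_⟩
    rw [mul_one, ← eq_dg h3 h1 hpos, mul_inv_cancel_left]

/-- A point whose orbit has bounded steps and positive linear speed in both directions has a
tracking geodesic, unless its forward and backward orbits are sublinearly close. -/
lemma exists_tracks {C : ℝ} (hC : ∀ z, dist z (F z) ≤ C) (hθ : 0 < θ)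
    (hfwd : Tendsto (fun n : ℕ => dist (F^[n] z) z / n) atTop (𝓝 θ))
    (hbwd : Tendsto (fun n : ℕ => dist (F.symm^[n] z) z / n) atTop (𝓝 θ))
    (hne : ¬ Tendsto (fun n : ℕ => dist (F^[n] z) (F.symm^[n] z) / n) atTop (𝓝 0)) :
    ∃ g, Tracks F θ z (geo g) := by
  obtain ⟨u, rfl⟩ := MulAction.exists_smul_eq SL(2, ℝ) I z
  have hd : ∀ w, dist (u⁻¹ • w) I = dist w (u • I) := fun w => by
    rw [← dist_smul u, smul_inv_smul]
  have hd' : ∀ w a t, dist (u⁻¹ • w) (geo a t) = dist w (geo (u * a) t) := fun w a t => by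
    rw [← dist_smul u, smul_inv_smul, geo_mul]
  obtain ⟨p, q, h, hray⟩ := exists_ray_tracking (x := fun n => u⁻¹ • F^[n] (u • I)) (C := C)
    (fun n => by rw [dist_smul, Function.iterate_succ_apply']; exact hC _) hθ
    (by simpa only [hd] using hfwd)
  obtain ⟨p', q', h', hray'⟩ := exists_ray_tracking (x := fun n => u⁻¹ • F.symm^[n] (u • I)) (C := C)
    (fun n => by
      rw [dist_smul, Function.iterate_succ_apply', dist_comm]
      conv_lhs => rw [← F.apply_symm_apply (F.symm^[n] (u • I)), F.symm_apply_apply]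
      exact hC _) hθ
    (by simpa only [hd] using hbwd)
  simp only [hd'] at hray hray'
  rcases eq_or_ne (p * q' - q * p') 0 with h0 | h0
  · -- both rays have the same direction
    refine absurd ?_ hne
    rw [tendsto_div_nat_zero_iff fun _ => dist_nonneg]
    intro ε hε
    filter_upwards [hray (ε / 2) (by positivity), hray' (ε / 2) (by positivity)] with n h1 h2
    have hsame : geo (u * rot p q h) (n * θ) = geo (u * rot p' q' h') (n * θ) := by
      have hc : (p * p' + q * q') ^ 2 = 1 := by
        have : (p * p' + q * q') ^ 2 + (p * q' - q * p') ^ 2 = 1 := by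
          linear_combination (p' ^ 2 + q' ^ 2) * h + h'
        rwa [h0, zero_pow two_ne_zero, add_zero] at this
      rw [geo_mul, geo_mul]
      congr 1
      rw [← dist_eq_zero]
      have h5 := two_cosh_dist_polar h h' (n * θ) (n * θ)
      rw [hc, h0, sub_self, Real.cosh_zero] at h5
      have h6 : Real.cosh (dist (geo (rot p q h) (n * θ)) (geo (rot p' q' h') (n * θ))) = 1 := by
        linarith
      by_contra hne0
      exact (Real.one_lt_cosh.2 hne0).ne' h6
    rw [hsame] at h1
    linarith [dist_triangle_right (F^[n] (u • I)) (F.symm^[n] (u • I))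
      (geo (u * rot p' q' h') (n * θ))]
  -- The geodesic joining the endpoints `p' / q'` and `p / q` of the two rays, the images of `0` and
  -- `∞`; the division makes the determinant one.
  · let g : SL(2, ℝ) := ⟨!![p, p' / (p * q' - q * p'); q, q' / (p * q' - q * p')], by
      rw [Matrix.det_fin_two_of]; field_simp⟩
    have g00 : g 0 0 = p := rfl
    have g01 : g 0 1 = p' / (p * q' - q * p') := rfl
    have g10 : g 1 0 = q := rfl
    have g11 : g 1 1 = q' / (p * q' - q * p') := rfl
    have cancel : ∀ a b : SL(2, ℝ), (u * a)⁻¹ * (u * b) = a⁻¹ * b := fun a b => by group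
    obtain ⟨B, hB⟩ := exists_dist_geo_le (h := u * g) (g := u * rot p q h) (by
      rw [cancel, mul_apply_two, inv_apply_10, inv_apply_11, g10, g00, rot_00, rot_10]; ring)
    obtain ⟨B', hB'⟩ := exists_dist_geo_le (h := u * (g * weyl)) (g := u * rot p' q' h') (by
      rw [cancel, mul_apply_two, inv_apply_10, inv_apply_11, mul_apply_two, mul_apply_two, g10, g00,
        g01, g11, rot_00, rot_10, weyl_00, weyl_10]; ring)
    refine ⟨u * g, tracks_iff.2 ⟨fun ε hε => ?_, fun ε hε => ?_⟩⟩
    · filter_upwards [hray (ε / 2) (by positivity), eventually_const_le_mul B (half_pos hε)]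
        with n h1 h2
      have := hB (n * θ) (by positivity)
      linarith [dist_triangle (F^[n] (u • I)) (geo (u * rot p q h) (n * θ)) (geo (u * g) (n * θ))]
    · filter_upwards [hray' (ε / 2) (by positivity), eventually_const_le_mul B' (half_pos hε)]
        with n h1 h2
      have := hB' (n * θ) (by positivity)
      rw [← mul_assoc, geo_mul_weyl] at this
      linarith [dist_triangle (F.symm^[n] (u • I)) (geo (u * rot p' q' h') (n * θ))
        (geo (u * g) (-(n * θ)))]

end Tracking

/-! ### Almost every point has a tracking geodesic -/

section Lift

variable {Γ : Subgroup SL(2, ℝ)} {f : Surface Γ ≃ₜ Surface Γ} {F : ℍ ≃ₜ ℍ}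

lemma IsPreferredLift.symm (hF : IsPreferredLift Γ f F) : IsPreferredLift Γ f.symm F.symm := by
  refine ⟨fun z => ?_, fun g hg => symm_smul (hF.commutes g hg)⟩
  apply f.injective
  rw [f.apply_symm_apply, ← hF.lifts, F.apply_symm_apply]

lemma IsPreferredLift.proj_iterate (hF : IsPreferredLift Γ f F) (n : ℕ) (z : ℍ) :
    proj Γ (F^[n] z) = f^[n] (proj Γ z) :=
  (Function.Semiconj.iterate_right (f := proj Γ) (ga := F) (gb := f) hF.lifts n z)

lemma IsPreferredLift.rotDist_proj (hF : IsPreferredLift Γ f F) (n : ℕ) (z : ℍ) :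
    rotDist Γ F n (proj Γ z) = dist z (F^[n] z) := by
  obtain ⟨T, hT, h⟩ := proj_eq_iff.1 (proj_out (proj Γ z))
  rw [rotDist, ← h, iterate_smul (hF.commutes T hT), dist_smul]

lemma iterate_symm_iterate (F : ℍ ≃ₜ ℍ) (n : ℕ) (z : ℍ) : F^[n] (F.symm^[n] z) = z :=
  Function.LeftInverse.iterate F.apply_symm_apply n z

lemma IsPreferredLift.rotDist_symm (hF : IsPreferredLift Γ f F) (n : ℕ) (z : ℍ) :
    rotDist Γ F n (f.symm^[n] (proj Γ z)) = dist (F.symm^[n] z) z := by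
  rw [← hF.symm.proj_iterate, hF.rotDist_proj, iterate_symm_iterate]

lemma IsPreferredLift.continuous_rotDist (hF : IsPreferredLift Γ f F) (n : ℕ) :
    Continuous (rotDist Γ F n) := by
  rw [(isQuotientMap_proj Γ).continuous_iff]
  have : rotDist Γ F n ∘ proj Γ = fun z => dist z (F^[n] z) := funext fun z => hF.rotDist_proj n z
  rw [this]
  exact continuous_id.dist (F.continuous.iterate n)

/-- The displacement of `F` is invariant under `Γ`, hence a continuous function on a compact
surface. -/
lemma IsPreferredLift.exists_step_bound (hF : IsPreferredLift Γ f F) (hΓ : IsClosedSurfaceGroup Γ) :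
    ∃ C, ∀ z, dist z (F z) ≤ C := by
  have := hΓ.cocompact
  obtain ⟨C, hC⟩ := (isCompact_range (hF.continuous_rotDist 1)).bddAbove
  refine ⟨C, fun z => ?_⟩
  have := hC ⟨proj Γ z, rfl⟩
  rwa [hF.rotDist_proj] at this

/-- It remains to exclude that the forward and backward orbits are sublinearly close. The distance
between the iterates of orders `n` and `-n` is the rotation distance of order `2n` at the n-th
backward image, distributed as at the point itself by invariance. -/
lemma IsPreferredLift.ae_exists_tracks (hF : IsPreferredLift Γ f F) (hΓ : IsClosedSurfaceGroup Γ)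
    {μ : Measure (Surface Γ)} [IsProbabilityMeasure μ] (hf : MeasurePreserving f μ μ) {θ : ℝ}
    (hθ : 0 < θ) (hrot : ∀ᵐ x ∂μ, HasRotationSpeed Γ f F x θ) :
    ∀ᵐ x ∂μ, ∀ z, proj Γ z = x → ∃ g, Tracks F θ z (geo g) := by
  obtain ⟨C, hC⟩ := hF.exists_step_bound hΓ
  set φ : ℕ → Surface Γ → ℝ := fun n x => rotDist Γ F (2 * n) x / n with hφ
  have hφc : ∀ n, Continuous (φ n) := fun n => (hF.continuous_rotDist _).div_const _
  have hmeas : TendstoInMeasure μ φ atTop fun _ => 2 * θ := by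
    refine tendstoInMeasure_of_tendsto_ae (fun n => (hφc n).aestronglyMeasurable) ?_
    filter_upwards [hrot] with x hx
    have h1 : Tendsto (fun n : ℕ => 2 * n) atTop atTop := tendsto_id.const_mul_atTop' two_pos
    refine ((hx.1.comp h1).const_mul 2).congr fun n => ?_
    simp only [hφ, Function.comp]
    push_cast
    rw [mul_div_assoc', mul_div_mul_left _ _ two_ne_zero]
  have hfs : MeasurePreserving f.symm μ μ :=
    MeasurePreserving.symm (e := f.toMeasurableEquiv) hf
  -- Composing with the varying maps `f.symm^[n]` may destroy almost everywhere convergence but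
  -- preserves convergence in measure. A subsequence converging to `2 * θ` suffices to exclude the
  -- limit zero.
  have hmeas' : TendstoInMeasure μ (fun n x => φ n (f.symm^[n] x)) atTop fun _ => 2 * θ := by
    intro ε hε
    refine (hmeas ε hε).congr fun n => ?_
    have hms : MeasurableSet {x | ε ≤ edist (φ n x) (2 * θ)} :=
      measurableSet_le measurable_const ((hφc n).edist continuous_const).measurable
    exact ((hfs.iterate n).measure_preimage hms.nullMeasurableSet).symm
  obtain ⟨ns, hns, hlim⟩ := hmeas'.exists_seq_tendsto_ae
  filter_upwards [hrot, hlim] with x hx hxlim z hz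
  subst hz
  refine exists_tracks hC hθ ?_ ?_ fun h0 => ?_
  · simpa only [hF.rotDist_proj, dist_comm z] using hx.1
  · simpa only [hF.rotDist_symm] using hx.2
  · have h1 : ∀ n, φ n (f.symm^[n] (proj Γ z)) = dist (F^[n] z) (F.symm^[n] z) / n := fun n => by
      simp only [hφ]
      rw [← hF.symm.proj_iterate, hF.rotDist_proj, two_mul, Function.iterate_add_apply,
        iterate_symm_iterate, dist_comm]
    simp only [h1] at hxlim
    have := tendsto_nhds_unique hxlim (h0.comp hns.tendsto_atTop)
    linarith

end Lift

/-! ### Recurrence of tracking geodesics -/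

section Recurrence

variable {Γ : Subgroup SL(2, ℝ)} {f : Surface Γ ≃ₜ Surface Γ} {F : ℍ ≃ₜ ℍ} {θ : ℝ} {z : ℍ}
  {g : SL(2, ℝ)} {μ : Measure (Surface Γ)}

lemma Tracks.of_dist_orbit_le {c : ℝ → ℍ} (h : Tracks F θ z c) {w : ℍ} {C : ℝ}
    (h1 : ∀ n, dist (F^[n] z) (F^[n] w) ≤ C) (h2 : ∀ n, dist (F.symm^[n] z) (F.symm^[n] w) ≤ C) :
    Tracks F θ w c := by
  rw [tracks_iff] at h ⊢
  constructor <;> intro ε hε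
  · filter_upwards [h.1 (ε / 2) (by positivity), eventually_const_le_mul C (half_pos hε)] with n h3 h4
    linarith [dist_triangle_left (F^[n] w) (c (n * θ)) (F^[n] z), h1 n]
  · filter_upwards [h.2 (ε / 2) (by positivity), eventually_const_le_mul C (half_pos hε)] with n h3 h4
    linarith [dist_triangle_left (F.symm^[n] w) (c (-(n * θ))) (F.symm^[n] z), h2 n]

/-- The orbits of `z` and `F z` stay at bounded distance, so tracking geodesics are constant along
orbits. -/
lemma Tracks.apply {c : ℝ → ℍ} (h : Tracks F θ z c) {C : ℝ} (hC : ∀ w, dist w (F w) ≤ C) :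
    Tracks F θ (F z) c := by
  refine h.of_dist_orbit_le (C := C) (fun n => ?_) fun n => ?_
  · rw [← Function.iterate_succ_apply, Function.iterate_succ_apply']
    exact hC _
  · have hcomm : Function.Commute F.symm F := fun w => by
      rw [F.symm_apply_apply, F.apply_symm_apply]
    rw [(hcomm.iterate_left n) z]
    exact hC _

lemma Tracks.iterate {c : ℝ → ℍ} (h : Tracks F θ z c) {C : ℝ} (hC : ∀ w, dist w (F w) ≤ C) (n : ℕ) :
    Tracks F θ (F^[n] z) c := by
  induction n with
  | zero => exact h
  | succ n ih => rw [Function.iterate_succ_apply']; exact ih.apply hC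

/-- The points whose tracking geodesics, together with a base point, have a property `W`. -/
def trackedSet (Γ : Subgroup SL(2, ℝ)) (F : ℍ ≃ₜ ℍ) (θ : ℝ) (W : Set (ℍ × SL(2, ℝ))) :
    Set (Surface Γ) :=
  {x | ∃ z g, proj Γ z = x ∧ Tracks F θ z (geo g) ∧ (z, g) ∈ W}

/-- Invariance under `Γ` and under reparametrization of the geodesic. -/
def IsParamInvariant (Γ : Subgroup SL(2, ℝ)) (W : Set (ℍ × SL(2, ℝ))) : Prop :=
  ∀ z g, (z, g) ∈ W → ∀ T ∈ Γ, ∀ (s : ℝ) (e : SL(2, ℝ)), (e = 1 ∨ e = -1) →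
    (T • z, T * g * dg s * e) ∈ W

/-- Uniqueness of tracking geodesics removes the choice of `z` and `g`. -/
lemma mem_trackedSet_iff (hF : IsPreferredLift Γ f F) (hθ : 0 < θ) {W : Set (ℍ × SL(2, ℝ))}
    (hW : IsParamInvariant Γ W) (hg : Tracks F θ z (geo g)) :
    proj Γ z ∈ trackedSet Γ F θ W ↔ (z, g) ∈ W := by
  refine ⟨?_, fun h => ⟨z, g, rfl, hg, h⟩⟩
  rintro ⟨w, h, hw, hh, hmem⟩
  obtain ⟨T, hT, rfl⟩ := proj_eq_iff.1 hw.symm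
  obtain ⟨s, e, he, rfl⟩ := (hh.smul (hF.commutes T hT)).unique hθ hg
  exact hW _ _ hmem T hT s e he

lemma measurableSet_tracks [MeasurableSpace (ℍ × SL(2, ℝ))] [BorelSpace (ℍ × SL(2, ℝ))]
    (F : ℍ ≃ₜ ℍ) (θ : ℝ) : MeasurableSet {p : ℍ × SL(2, ℝ) | Tracks F θ p.1 (geo p.2)} := by
  have hgeo : ∀ t, Continuous fun p : ℍ × SL(2, ℝ) => geo p.2 t := fun t =>
    continuous_geo₂.comp (f := fun p : ℍ × SL(2, ℝ) => (p.2, t)) (by fun_prop)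
  have key : ∀ a : ℕ → ℍ × SL(2, ℝ) → ℝ, (∀ n, Continuous (a n)) →
      MeasurableSet {p | Tendsto (fun n => a n p) atTop (𝓝 0)} := fun a ha =>
    measurableSet_tendsto _ fun n => (ha n).measurable
  exact (key (fun n p => dist (F^[n] p.1) (geo p.2 (n * θ)) / n) fun n =>
    (((F.continuous.iterate n).comp continuous_fst).dist (hgeo _)).div_const _).inter
      (key (fun n p => dist (F.symm^[n] p.1) (geo p.2 (-(n * θ))) / n) fun n =>
        (((F.symm.continuous.iterate n).comp continuous_fst).dist (hgeo _)).div_const _)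

/-- If almost every point is tracked, invariant Borel properties of the tracking geodesic are
measurable. -/
lemma nullMeasurableSet_trackedSet (hΓ : IsClosedSurfaceGroup Γ) (hF : IsPreferredLift Γ f F)
    (hθ : 0 < θ) (htr : ∀ᵐ x ∂μ, ∀ z, proj Γ z = x → ∃ g, Tracks F θ z (geo g))
    {W : Set (ℍ × SL(2, ℝ))} (hW : IsParamInvariant Γ W) (ho : IsOpen W) :
    NullMeasurableSet (trackedSet Γ F θ W) μ := by
  have := hΓ.t2Space
  let : MeasurableSpace (ℍ × SL(2, ℝ)) := borel _
  have : BorelSpace (ℍ × SL(2, ℝ)) := ⟨rfl⟩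
  obtain ⟨t, hts, ht, ht0⟩ := exists_measurable_superset_of_null (ae_iff.1 htr)
  have hπ : Continuous fun p : ℍ × SL(2, ℝ) => proj Γ p.1 := (continuous_proj Γ).comp continuous_fst
  have htm : MeasurableSet {p : ℍ × SL(2, ℝ) | proj Γ p.1 ∈ t} := hπ.measurable ht
  have hX := measurableSet_tracks F θ
  have hA : AnalyticSet (trackedSet Γ F θ W \ t) := by
    have : trackedSet Γ F θ W \ t = (fun p : ℍ × SL(2, ℝ) => proj Γ p.1) ''
        (({p | Tracks F θ p.1 (geo p.2)} ∩ W) \ {p | proj Γ p.1 ∈ t}) := by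
      ext x
      constructor
      · rintro ⟨⟨z, g, rfl, hg, h⟩, hx⟩
        exact ⟨(z, g), ⟨⟨hg, h⟩, hx⟩, rfl⟩
      · rintro ⟨⟨z, g⟩, ⟨⟨hg, h⟩, hx⟩, rfl⟩
        exact ⟨⟨z, g, rfl, hg, h⟩, hx⟩
    rw [this]
    exact ((hX.inter ho.measurableSet).diff htm).analyticSet.image_of_continuous hπ
  -- Outside `t` every point is tracked, so by uniqueness the complement is a projection of a Borel
  -- set too. A set which is analytic together with its complement is Borel.
  have hB : AnalyticSet (trackedSet Γ F θ W \ t)ᶜ := by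
    have : (trackedSet Γ F θ W \ t)ᶜ = (fun p : ℍ × SL(2, ℝ) => proj Γ p.1) ''
        (({p | Tracks F θ p.1 (geo p.2)} \ W) ∪ {p | proj Γ p.1 ∈ t}) := by
      ext x
      obtain ⟨z, rfl⟩ := proj_surjective Γ x
      constructor
      · intro hx
        by_cases hxt : proj Γ z ∈ t
        · exact ⟨(z, 1), Or.inr hxt, rfl⟩
        · obtain ⟨g, hg⟩ : ∃ g, Tracks F θ z (geo g) := by
            by_contra hcon
            exact hxt (hts fun h => hcon (h z rfl))
          exact ⟨(z, g), Or.inl ⟨hg, fun h => hx ⟨⟨z, g, rfl, hg, h⟩, hxt⟩⟩, rfl⟩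
      · rintro ⟨⟨w, g⟩, ⟨hg, h⟩ | h, hw⟩ ⟨hx, hxt⟩
        · rw [← hw] at hx
          exact h ((mem_trackedSet_iff hF hθ hW hg).1 hx)
        · rw [← hw] at hxt
          exact hxt h
    rw [this]
    exact ((hX.diff ho.measurableSet).union htm).analyticSet.image_of_continuous hπ
  have hm : MeasurableSet (trackedSet Γ F θ W \ t) := hA.measurableSet_of_compl hB
  exact hm.nullMeasurableSet.congr (sdiff_null_ae_eq_self ht0)

lemma flowOrbit_mul (Γ : Subgroup SL(2, ℝ)) (g : SL(2, ℝ)) {T : SL(2, ℝ)} (hT : T ∈ Γ) (s : ℝ)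
    {e : SL(2, ℝ)} (he : e = 1 ∨ e = -1) : flowOrbit Γ (T * g * dg s * e) = flowOrbit Γ g := by
  have hq : dg s * e ∈ Nrm := by
    refine Nrm.mul_mem (dg_mem_Nrm s) ?_
    rcases he with rfl | rfl
    · exact Nrm.one_mem
    · exact neg_one_mem_Nrm
  ext h
  constructor
  · rintro ⟨T', hT', q, hq', rfl⟩
    exact ⟨T' * T, Γ.mul_mem hT' hT, dg s * e * q, Nrm.mul_mem hq hq', by simp only [mul_assoc]⟩
  · rintro ⟨T', hT', q, hq', rfl⟩
    refine ⟨T' * T⁻¹, Γ.mul_mem hT' (Γ.inv_mem hT), (dg s * e)⁻¹ * q,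
      Nrm.mul_mem (Nrm.inv_mem hq) hq', ?_⟩
    group

/-- The closure of the tracking geodesic is almost everywhere constant. -/
lemma exists_closure_flowOrbit_eq (hΓ : IsClosedSurfaceGroup Γ) (hF : IsPreferredLift Γ f F)
    (hθ : 0 < θ) (hf : Ergodic f μ)
    (htr : ∀ᵐ x ∂μ, ∀ z, proj Γ z = x → ∃ g, Tracks F θ z (geo g)) :
    ∃ L : Set SL(2, ℝ), ∀ᵐ x ∂μ, ∀ z g, proj Γ z = x → Tracks F θ z (geo g) →
      closure (flowOrbit Γ g) = L := by
  obtain ⟨C, hC⟩ := hF.exists_step_bound hΓ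
  set W : Set SL(2, ℝ) → Set (ℍ × SL(2, ℝ)) := fun V => {p | (flowOrbit Γ p.2 ∩ V).Nonempty} with hWdef
  have hW : ∀ V, IsParamInvariant Γ (W V) := by
    intro V z g h T hT s e he
    simp only [hWdef, mem_ofPred_eq] at h ⊢
    rwa [flowOrbit_mul Γ g hT s he]
  have hWo : ∀ V, IsOpen V → IsOpen (W V) := by
    intro V hV
    have : W V = ⋃ T ∈ Γ, ⋃ q ∈ Nrm, (fun p : ℍ × SL(2, ℝ) => T * p.2 * q) ⁻¹' V := by
      ext p
      simp only [hWdef, mem_ofPred_eq, mem_iUnion, exists_prop, mem_preimage]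
      constructor
      · rintro ⟨_, ⟨T, hT, q, hq, rfl⟩, h⟩
        exact ⟨T, hT, q, hq, h⟩
      · rintro ⟨T, hT, q, hq, h⟩
        exact ⟨_, ⟨T, hT, q, hq, rfl⟩, h⟩
    rw [this]
    exact isOpen_biUnion fun T _ => isOpen_biUnion fun q _ => hV.preimage (by fun_prop)
  have hconst : ∀ V, IsOpen V → ∃ P : Prop, ∀ᵐ x ∂μ, x ∈ trackedSet Γ F θ (W V) ↔ P := by
    intro V hV
    have hinv : f ⁻¹' trackedSet Γ F θ (W V) =ᵐ[μ] trackedSet Γ F θ (W V) := by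
      refine eventuallyEq_set.2 ?_
      filter_upwards [htr] with x hx
      obtain ⟨z, rfl⟩ := proj_surjective Γ x
      obtain ⟨g, hg⟩ := hx z rfl
      rw [mem_preimage, ← hF.lifts, mem_trackedSet_iff hF hθ (hW V) hg,
        mem_trackedSet_iff hF hθ (hW V) (hg.apply hC)]
      rfl
    rcases hf.quasiErgodic.ae_empty_or_univ₀
      (nullMeasurableSet_trackedSet hΓ hF hθ htr (hW V) (hWo V hV)) hinv with h | h
    · exact ⟨False, (eventuallyEq_set.1 h).mono fun x hx => by simpa using hx⟩
    · exact ⟨True, (eventuallyEq_set.1 h).mono fun x hx => by simpa using hx⟩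
  choose! P hP using hconst
  -- A closed set is determined by the basic open sets it meets, and meeting each of these is almost
  -- surely decided.
  refine ⟨{h | ∀ V ∈ TopologicalSpace.countableBasis SL(2, ℝ), h ∈ V → P V}, ?_⟩
  have hall : ∀ᵐ x ∂μ, ∀ V ∈ TopologicalSpace.countableBasis SL(2, ℝ),
      x ∈ trackedSet Γ F θ (W V) ↔ P V :=
    (ae_ball_iff (TopologicalSpace.countable_countableBasis _)).2 fun V hV =>
      hP V (TopologicalSpace.isOpen_of_mem_countableBasis hV)
  filter_upwards [hall] with x hx z g hz hg
  subst hz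
  ext h
  rw [(TopologicalSpace.isBasis_countableBasis SL(2, ℝ)).mem_closure_iff]
  refine forall₃_congr fun V hV _ => ?_
  rw [← hx V hV, mem_trackedSet_iff hF hθ (hW V) hg, inter_comm]
  rfl

/-- Almost every tracking geodesic is recurrent. -/
lemma ae_isForwardRecurrent (hΓ : IsClosedSurfaceGroup Γ) (hF : IsPreferredLift Γ f F)
    (hθ : 0 < θ) [IsFiniteMeasure μ] (hf : MeasurePreserving f μ μ)
    (htr : ∀ᵐ x ∂μ, ∀ z, proj Γ z = x → ∃ g, Tracks F θ z (geo g)) :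
    ∀ᵐ x ∂μ, ∀ z g, proj Γ z = x → Tracks F θ z (geo g) → IsForwardRecurrent Γ g := by
  obtain ⟨C, hC⟩ := hF.exists_step_bound hΓ
  set W : Set (ℍ × SL(2, ℝ)) → Set (ℍ × SL(2, ℝ)) := fun U =>
    {p | ∃ T ∈ Γ, ∃ s : ℝ, ∃ e : SL(2, ℝ), (e = 1 ∨ e = -1) ∧ (T • p.1, T * p.2 * dg s * e) ∈ U}
    with hWdef
  have hW : ∀ U, IsParamInvariant Γ (W U) := by
    rintro U z g ⟨T, hT, s, e, he, h⟩ S hS t ε hε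
    have hcomm : ∀ a : SL(2, ℝ), ε * a = a * ε := by rcases hε with rfl | rfl <;> simp
    have hsq : ε * ε = 1 := by rcases hε with rfl | rfl <;> simp
    refine ⟨T * S⁻¹, Γ.mul_mem hT (Γ.inv_mem hS), s - t, ε * e, ?_, ?_⟩
    · rcases hε with rfl | rfl <;> rcases he with rfl | rfl <;> simp
    · have h1 : (T * S⁻¹) • S • z = T • z := by rw [mul_smul, inv_smul_smul]
      have h2 : T * S⁻¹ * (S * g * dg t * ε) * dg (s - t) * (ε * e) = T * g * dg s * e := by
        calc _ = T * g * dg t * (ε * dg (s - t)) * ε * e := by group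
          _ = T * g * (dg t * dg (s - t)) * (ε * ε) * e := by rw [hcomm]; simp only [mul_assoc]
          _ = _ := by rw [hsq, ← dg_add, add_sub_cancel, mul_one]
      simp only [h1, h2]
      exact h
  have hWo : ∀ U, IsOpen U → IsOpen (W U) := by
    intro U hU
    have : W U = ⋃ T ∈ Γ, ⋃ s : ℝ, ⋃ e : SL(2, ℝ), ⋃ _ : e = 1 ∨ e = -1,
        (fun p : ℍ × SL(2, ℝ) => (T • p.1, T * p.2 * dg s * e)) ⁻¹' U := by
      ext p
      simp only [hWdef, mem_ofPred_eq, mem_iUnion, exists_prop, mem_preimage]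
    rw [this]
    exact isOpen_biUnion fun T _ => isOpen_iUnion fun s => isOpen_iUnion fun e => isOpen_iUnion fun _ =>
      hU.preimage ((continuous_fst.const_smul T).prodMk (by fun_prop))
  have hall : ∀ᵐ x ∂μ, ∀ U ∈ TopologicalSpace.countableBasis (ℍ × SL(2, ℝ)),
      x ∈ trackedSet Γ F θ (W U) → ∃ᶠ n in atTop, f^[n] x ∈ trackedSet Γ F θ (W U) :=
    (ae_ball_iff (TopologicalSpace.countable_countableBasis _)).2 fun U hU =>
      hf.conservative.ae_mem_imp_frequently_image_mem
        (nullMeasurableSet_trackedSet hΓ hF hθ htr (hW U)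
          (hWo U (TopologicalSpace.isOpen_of_mem_countableBasis hU)))
  filter_upwards [hall] with x hx z g hz hg V hV R
  subst hz
  have hgeo : ContinuousAt (fun p : ℍ × SL(2, ℝ) => dist p.1 (geo p.2 0)) (z, g) :=
    (continuous_fst.dist (continuous_geo₂.comp (f := fun p : ℍ × SL(2, ℝ) => (p.2, (0 : ℝ)))
      (by fun_prop))).continuousAt
  -- The distance bound keeps the returning base point near `geo g s`. As this point is also near
  -- `geo g (n * θ)`, a late return forces `s ≥ R`.
  have hN : {p : ℍ × SL(2, ℝ) | dist p.1 (geo p.2 0) < dist z (geo g 0) + 1 ∧ p.2 ∈ V} ∈ 𝓝 (z, g) :=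
    (hgeo.eventually_lt_const (by simp)).and (continuousAt_snd.preimage_mem_nhds hV)
  obtain ⟨U, hU, hzU, hUN⟩ :=
    (TopologicalSpace.isBasis_countableBasis (ℍ × SL(2, ℝ))).mem_nhds_iff.1 hN
  have hself : proj Γ z ∈ trackedSet Γ F θ (W U) :=
    ⟨z, g, rfl, hg, 1, Γ.one_mem, 0, 1, Or.inl rfl, by simpa [dg_zero] using hzU⟩
  obtain ⟨n, hn, hn1, hn2⟩ := ((hx U hU hself).and_eventually
    (((tracks_iff.1 hg).1 (θ / 2) (by positivity)).and
      (eventually_const_le_mul (R + (dist z (geo g 0) + 1)) (half_pos hθ)))).exists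
  rw [← hF.proj_iterate, mem_trackedSet_iff hF hθ (hW U) (hg.iterate hC n)] at hn
  obtain ⟨T, hT, s, e, he, hmem⟩ := hn
  obtain ⟨hd, hmemV⟩ := hUN hmem
  refine ⟨T, hT, s, ?_, e, he, hmemV⟩
  have h1 : dist (T • F^[n] z) (geo (T * g * dg s * e) 0) = dist (F^[n] z) (geo g s) := by
    have : geo (T * g * dg s * e) 0 = geo (T * (g * dg s)) 0 := by
      rcases he with rfl | rfl
      · rw [mul_one, mul_assoc]
      · rw [mul_neg_one, geo_neg, mul_assoc]
    rw [this, geo_mul, dist_smul, geo_mul_dg, add_zero]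
  simp only [h1] at hd
  have h2 : dist (geo g s) (geo g (n * θ)) = |s - n * θ| := dist_geo g _ _
  have h3 := dist_triangle_left (geo g s) (geo g (n * θ)) (F^[n] z)
  have h4 := neg_abs_le (s - n * θ)
  linarith

end Recurrence

/-! ### Normalized tracking geodesics -/

lemma exists_dist_geo_eq_infDist (z : ℍ) (g : SL(2, ℝ)) :
    ∃ s, dist z (geo g s) = Metric.infDist z (range (geo g)) := by
  have hcl : IsClosed (range (geo g)) := (isometry_geo g).isClosedEmbedding.isClosed_range
  obtain ⟨_, ⟨s, rfl⟩, hs⟩ := hcl.exists_infDist_eq_dist (range_nonempty _) z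
  exact ⟨s, hs.symm⟩

section Normalized

variable {Γ : Subgroup SL(2, ℝ)} {f : Surface Γ ≃ₜ Surface Γ} {F : ℍ ≃ₜ ℍ} {θ : ℝ} {z : ℍ}
  {g : SL(2, ℝ)}

lemma Tracks.exists_isNormalizedTracking (hΓ : IsClosedSurfaceGroup Γ) (hF : IsPreferredLift Γ f F)
    (hθ : 0 < θ) (hrot : HasRotationSpeed Γ f F (proj Γ z) θ) (hg : Tracks F θ z (geo g)) :
    ∃ s, IsNormalizedTracking Γ f F (proj Γ z) fun t => proj Γ (geo (g * dg s) t) := by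
  obtain ⟨s, hs⟩ := exists_dist_geo_eq_infDist z g
  have hr : range (geo (g * dg s)) = range (geo g) := range_geo_mul (dg_mem_Nrm s) g
  refine ⟨s, ⟨isGeodesic_proj_geo hΓ _, θ, hθ, hrot, ?_⟩, θ, z, geo (g * dg s), hrot, rfl,
    ⟨isometry_geo _, fun t => rfl⟩, hg.mul_dg s, ?_⟩
  · intro w hw
    obtain ⟨T, hT, rfl⟩ := proj_eq_iff.1 hw
    refine ⟨geo (T * (g * dg s)), ⟨isometry_geo _, fun t => ?_⟩,
      (hg.mul_dg s).smul (hF.commutes T hT)⟩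
    rw [geo_mul, proj_smul hT]
  · rw [hr, ← hs, geo_mul_dg, add_zero]

/-- Uniqueness of the rotation speed identifies the speed hidden in the definition with the given
one. -/
lemma IsNormalizedTracking.exists_tracks {x : Surface Γ} {γ : ℝ → Surface Γ}
    (h : IsNormalizedTracking Γ f F x γ) (hrot : HasRotationSpeed Γ f F x θ) :
    ∃ z g, proj Γ z = x ∧ Tracks F θ z (geo g) ∧ γ = fun t => proj Γ (geo g t) := by
  obtain ⟨-, θ', z, c, hrot', hz, ⟨hc, hcγ⟩, htr, -⟩ := h
  obtain ⟨g, rfl⟩ := exists_eq_geo hc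
  obtain rfl := tendsto_nhds_unique hrot.1 hrot'.1
  exact ⟨z, g, hz, htr, funext fun t => (hcγ t).symm⟩

end Normalized

end HypSurf

/-! ### Assembly: the lamination read off from one generic point -/

theorem theorem1p10 (Γ : Subgroup SL(2, ℝ)) (hΓ : IsClosedSurfaceGroup Γ)
    (f : Surface Γ ≃ₜ Surface Γ) (hf : IsotopicToId f)
    (F : ℍ ≃ₜ ℍ) (hF : IsPreferredLift Γ f F)
    (μ : Measure (Surface Γ)) (hμ : IsErgodicPosSpeed Γ f F μ)
    (hsimple : ∀ᵐ x ∂μ, ∀ γ : ℝ → Surface Γ,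
      IsNormalizedTracking Γ f F x γ → IsSimpleGeodesic Γ γ) :
    ∃ Λ : Set (Surface Γ), IsMinimalGeodesicLamination Γ Λ ∧
      ∀ᵐ x ∂μ, (∃ γ : ℝ → Surface Γ, IsNormalizedTracking Γ f F x γ) ∧
        ∀ γ : ℝ → Surface Γ, IsNormalizedTracking Γ f F x γ → closure (range γ) = Λ := by
  obtain ⟨hprob, herg, θ, hθ, hrot⟩ := hμ
  have htr := hF.ae_exists_tracks hΓ herg.toMeasurePreserving hθ hrot
  have hsymm : MeasurePreserving f.symm μ μ :=
    MeasurePreserving.symm (e := f.toMeasurableEquiv) herg.toMeasurePreserving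
  have htr' : ∀ᵐ x ∂μ, ∀ z, proj Γ z = x → ∃ g, Tracks F.symm θ z (geo g) :=
    htr.mono fun x hx z hz => (hx z hz).imp' (· * weyl) fun g hg => hg.symm
  obtain ⟨L, hL⟩ := exists_closure_flowOrbit_eq hΓ hF hθ herg htr
  have hfwd := ae_isForwardRecurrent hΓ hF hθ herg.toMeasurePreserving htr
  have hbwd := ae_isForwardRecurrent hΓ hF.symm hθ hsymm htr'
  have hex : ∀ᵐ x ∂μ, ∃ z g, proj Γ z = x ∧ Tracks F θ z (geo g) :=
    htr.mono fun x hx => by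
      obtain ⟨z, hz⟩ := proj_surjective Γ x
      obtain ⟨g, hg⟩ := hx z hz
      exact ⟨z, g, hz, hg⟩
  obtain ⟨x₀, ⟨z₀, g, rfl, hg⟩, hrot₀, hL₀, hfwd₀, hbwd₀, hsimple₀⟩ :=
    (hex.and (hrot.and (hL.and (hfwd.and (hbwd.and hsimple))))).exists
  have hnc : ∀ T ∈ Γ, 0 ≤ crossProd (g⁻¹ * T * g) := by
    intro T hT
    obtain ⟨s, hs⟩ := hg.exists_isNormalizedTracking hΓ hF hθ hrot₀
    have := (hsimple₀ _ hs).crossProd_nonneg hΓ hT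
    -- Normalization only shifts the parameter, which does not affect crossings.
    have e : (g * dg s)⁻¹ * T * (g * dg s) = (dg s)⁻¹ * (g⁻¹ * T * g) * dg s := by group
    rwa [e, crossProd_mul_right (dg_mem_Nrm s),
      crossProd_mul_left (Nrm.inv_mem (dg_mem_Nrm s))] at this
  obtain rfl := hL₀ z₀ g rfl hg
  have hinv := (isFlowInvariant_flowOrbit Γ g).closure
  obtain ⟨β, hβ, hβ'⟩ := exists_isGeodesicLamination hΓ hinv isClosed_closure
    fun a ha b hb => crossProd_nonneg_of_closure hnc ha hb
  refine ⟨support Γ (closure (flowOrbit Γ g)), ⟨β, hβ, fun x hx => ?_⟩, ?_⟩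
  · obtain ⟨h, hh, hβh⟩ := hβ' x hx
    have hsub : closure (flowOrbit Γ h) ⊆ closure (flowOrbit Γ g) := by
      refine closure_minimal ?_ isClosed_closure
      rintro _ ⟨T, hT, q, hq, rfl⟩
      exact hinv.right q hq _ (hinv.left T hT h hh)
    have hinv' := (isFlowInvariant_flowOrbit Γ h).closure
    -- Minimality is applied with the closure of the leaf itself as closed invariant set.
    have hmem : g ∈ closure (flowOrbit Γ h) :=
      mem_of_isForwardRecurrent hΓ.exists_compact (hfwd₀ z₀ g rfl hg)
        (hbwd₀ z₀ _ rfl hg.symm) hnc hinv' isClosed_closure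
        ⟨h, subset_closure (mem_flowOrbit_self Γ h)⟩ hsub
    have hsub' : closure (flowOrbit Γ g) ⊆ closure (flowOrbit Γ h) := by
      refine closure_minimal ?_ isClosed_closure
      rintro _ ⟨T, hT, q, hq, rfl⟩
      exact hinv'.right q hq _ (hinv'.left T hT g hmem)
    rw [hβh, closure_range_eq_support, hsub.antisymm hsub']
  · filter_upwards [hex, hrot, hL] with x hx hrx hLx
    refine ⟨?_, fun γ hγ => ?_⟩
    · obtain ⟨z, h, rfl, hh⟩ := hx
      obtain ⟨s, hs⟩ := hh.exists_isNormalizedTracking hΓ hF hθ hrx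
      exact ⟨_, hs⟩
    · obtain ⟨z, h, hz, hh, rfl⟩ := hγ.exists_tracks hrx
      rw [closure_range_eq_support, hLx z h hz hh]
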